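/- Let $n\ge 1$ and $\mathfrak g=\mathfrak{gl}(n,\mathbb C)$. For $x\in\mathfrak g$ and $1\le i\le n$ let $x_i$ be the upper left $i\times i$ corner of $x$, regarded as an element of $\mathfrak g_i=\mathfrak{gl}(i,\mathbb C)$; embed $\mathfrak g_i$ in the upper left corner of $\mathfrak g$. Put $f_{i,j}(x)=\operatorname{tr}(x_i^j)$ for $1\le j\le i\le n$, and let $\Phi=(f_{i,j})_{1\le j\le i\le n}:\mathfrak g\to\mathbb C^{n(n+1)/2}$. An element $x$ is strongly regular if the differentials $(df_{i,j})_x$, $1\le j\le i\le n$, are linearly independent; $\Phi^{-1}(0)_{sreg}$ is the set of strongly regular $x$ with $\Phi(x)=0$. Let $A=\mathbb C^{n(n-1)/2}$ act on $\mathfrak g$ by letting $(t_{i,j})_{1\le j\le i\le n-1}$ act as the composition (in any order) of the commuting flows $x\mapsto \operatorname{Ad}(\exp(t_{i,j}\,j\,x_i^{j-1}))\,x$, where $x_i^{j-1}$ is computed in $\mathfrak g_i$ (so $x_i^0$ is the identity of $\mathfrak g_i$). For $2\le i\le n$ let $K_i=GL(i-1,\mathbb C)\times GL(1,\mathbb C)\subset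 GL(i,\mathbb C)$ be the group of invertible block diagonal matrices, acting by conjugation on the set of Borel (that is, maximal solvable) subalgebras of $\mathfrak g_i$, and let $Q_{+,i}$ and $Q_{-,i}$ be the $K_i$-orbits of the upper and of the lower triangular matrices. Then for each of the $2^{n-1}$ sequences $\mathcal Q=(Q_2,\dots,Q_n)$ with $Q_i\in\{Q_{+,i},Q_{-,i}\}$ there is exactly one Borel subalgebra $\mathfrak b_{\mathcal Q}$ of $\mathfrak g$ whose image under $x\mapsto x_i$ belongs to $Q_i$ for all $i=2,\dots,n$, and these $2^{n-1}$ Borel subalgebras are distinct. Let $\mathfrak n_{\mathcal Q}^{reg}$ be the set of nilpotent elements of $\mathfrak b_{\mathcal Q}$ that are regular in $\mathfrak g$, i.e. have centralizer in $\mathfrak g$ of dimension $n$. Then $$\Phi^{-1}(0)_{sreg}=\coprod_{\mathcal Q}\mathfrak n_{\mathcal Q}^{reg}$$ is a disjoint union; the sets $\mathfrak n_{\mathcal Q}^{reg}$ are exactly the irreducible components of $\Phi^{-1}(0)_{sreg}$ in the Zariski topology, and there are $2^{n-1}$ of them; and these components are exactly the $A$-orbits in $\Phi^{-1}(0)_{sreg}$.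 -/

import Mathlib

attribute [local instance] LieRing.ofAssociativeRing

namespace GelfandZeitlin

/-- `gl(n, ℂ)`, with the commutator bracket. -/
abbrev Mat (n : ℕ) : Type := Matrix (Fin n) (Fin n) ℂ

/-! ### Upper left corners -/

/-- The projection `gl(n) → gl(i)`, `x ↦ x_i`, onto the upper left `i × i` corner
(`x_i` is regarded as an `i × i` matrix). -/
def proj {n : ℕ} (i : ℕ) (hi : i ≤ n) : Mat n →ₗ[ℂ] Mat i where
  toFun x := x.submatrix (Fin.castLE hi) (Fin.castLE hi)
  map_add' _ _ := rfl
  map_smul' _ _ := rfl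

/-- The embedding of `gl(i)` in the upper left corner of `gl(n)`, all other entries being zero. -/
def embed (n : ℕ) {i : ℕ} (y : Mat i) : Mat n :=
  Matrix.of fun a b => if h : a.val < i ∧ b.val < i then y ⟨a, h.1⟩ ⟨b, h.2⟩ else 0

/-! ### The Kostant-Wallach map and strong regularity -/

/-- The map `Φ : gl(n) → ℂ^{n(n+1)/2}`. The coordinate at `⟨i, j⟩`, where `0 ≤ i ≤ n` and
`0 ≤ j < i`, is `f_{i, j+1}(x) = tr (x_i ^ (j+1))`; there are no coordinates with `i = 0`. -/
def kwMap {n : ℕ} (x : Mat n) : (Σ i : Fin (n + 1), Fin i.val) → ℂ :=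
  fun p => Matrix.trace (proj p.1.val (Nat.le_of_lt_succ p.1.isLt) x ^ (p.2.val + 1))

/-- `x` is strongly regular if the differentials at `x` of all the functions `f_{i,j}`,
`1 ≤ j ≤ i ≤ n`, are linearly independent. -/
def IsStronglyRegular {n : ℕ} (x : Mat n) : Prop :=
  LinearIndependent ℂ fun p : (Σ i : Fin (n + 1), Fin i.val) =>
    fderiv ℂ (fun y : Mat n => kwMap y p) x

/-- The strongly regular nilfiber `Φ⁻¹(0)_sreg`. -/
def nilfiberSreg (n : ℕ) : Set (Mat n) :=
  {x | kwMap x = 0 ∧ IsStronglyRegular x}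

/-! ### Borel subalgebras and the orbits `Q_{+,i}`, `Q_{-,i}` -/

/-- A Borel subalgebra of `gl(n)` is a maximal solvable subalgebra. -/
def IsBorel {n : ℕ} (b : LieSubalgebra ℂ (Mat n)) : Prop :=
  Maximal (fun c : LieSubalgebra ℂ (Mat n) => LieAlgebra.IsSolvable c) b

/-- The upper triangular matrices. -/
def upperTriangular (n : ℕ) : LieSubalgebra ℂ (Mat n) where
  carrier := {x | ∀ a b, b < a → x a b = 0}
  add_mem' := fun {x y} hx hy a b h => by simp [hx a b h, hy a b h]
  zero_mem' := fun _ _ _ => rfl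
  smul_mem' := fun c x hx a b h => by simp [hx a b h]
  lie_mem' := fun {x y} hx hy => by
    have h1 : Matrix.BlockTriangular x id := fun a b h => hx a b h
    have h2 : Matrix.BlockTriangular y id := fun a b h => hy a b h
    intro a b h
    rw [Ring.lie_def]
    exact ((h1.mul h2).sub (h2.mul h1)) h

/-- The lower triangular matrices. -/
def lowerTriangular (n : ℕ) : LieSubalgebra ℂ (Mat n) where
  carrier := {x | ∀ a b, a < b → x a b = 0}
  add_mem' := fun {x y} hx hy a b h => by simp [hx a b h, hy a b h]
  zero_mem' := fun _ _ _ => rfl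
  smul_mem' := fun c x hx a b h => by simp [hx a b h]
  lie_mem' := fun {x y} hx hy => by
    have h1 : Matrix.BlockTriangular x OrderDual.toDual := fun a b h => hx a b h
    have h2 : Matrix.BlockTriangular y OrderDual.toDual := fun a b h => hy a b h
    intro a b h
    rw [Ring.lie_def]
    exact ((h1.mul h2).sub (h2.mul h1)) h

/-- `k ∈ K_i = GL(i-1) × GL(1) ⊆ GL(i)`: the entries of `k` outside the diagonal blocks of
sizes `i - 1` and `1` vanish. -/
def InK {i : ℕ} (k : GL (Fin i) ℂ) : Prop :=
  ∀ a b : Fin i, ¬ (a.val + 1 = i ↔ b.val + 1 = i) → (k : Mat i) a b = 0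

/-- The subalgebra `Ad(k) b = k b k⁻¹`. -/
noncomputable def conjSubalgebra {i : ℕ} (k : GL (Fin i) ℂ) (b : LieSubalgebra ℂ (Mat i)) :
    LieSubalgebra ℂ (Mat i) :=
  b.map (Matrix.lieConj (k : Mat i) k.invertible).toLieHom

/-- The orbit `K_i · b`. -/
def orbitK {i : ℕ} (b : LieSubalgebra ℂ (Mat i)) : Set (LieSubalgebra ℂ (Mat i)) :=
  {c | ∃ k : GL (Fin i) ℂ, InK k ∧ c = conjSubalgebra k b}

/-- The orbit `Q_{+,i}` (for `true`) of the upper triangular matrices, or the orbit `Q_{-,i}`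
(for `false`) of the lower triangular matrices. -/
def orbitQ (i : ℕ) (s : Bool) : Set (LieSubalgebra ℂ (Mat i)) :=
  orbitK (if s then upperTriangular i else lowerTriangular i)

/-- The set `X_𝒬` of the Borel subalgebras `b` of `gl(n)` such that `b_i ∈ Q_i` for
`i = 2, …, n`, where `b_i` is the image of `b` in `gl(i)`. The sequence
`𝒬 = (Q_2, …, Q_n)` is given by the signs `s 0, …, s (n - 2)`, that of `Q_i` being
`s (i - 2)`. -/
def towerBorels {n : ℕ} (s : Fin (n - 1) → Bool) : Set (LieSubalgebra ℂ (Mat n)) :=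
  {b | IsBorel b ∧ ∀ m : Fin (n - 1), ∃ c ∈ orbitQ (m.val + 2) (s m),
    c.toSubmodule = b.toSubmodule.map (proj (m.val + 2) (by have := m.isLt; omega))}

/-- `x ∈ gl(n)` is regular if its centralizer has the minimal dimension `n`, the rank of
`gl(n)`. -/
def IsRegularElt {n : ℕ} (x : Mat n) : Prop :=
  Module.finrank ℂ (LinearMap.ker (LieAlgebra.ad ℂ (Mat n) x)) = n

/-- The set of the regular nilpotent elements of `gl(n)` that lie in `b`. -/
def regNilpotents {n : ℕ} (b : LieSubalgebra ℂ (Mat n)) : Set (Mat n) :=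
  {x | x ∈ b ∧ IsNilpotent x ∧ IsRegularElt x}

/-! ### The Zariski topology -/

/-- The common zeros in `gl(n) = ℂ^{n²}` of a set of polynomials in the matrix entries. -/
def zeroSet {n : ℕ} (F : Set (MvPolynomial (Fin n × Fin n) ℂ)) : Set (Mat n) :=
  {x | ∀ p ∈ F, MvPolynomial.eval (fun ab => x ab.1 ab.2) p = 0}

/-- The Zariski topology on `gl(n)`. -/
@[reducible] def zariski (n : ℕ) : TopologicalSpace (Mat n) :=
  TopologicalSpace.ofClosed (Set.range zeroSet)
    ⟨{1}, by ext x; simp [zeroSet]⟩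
    (by
      intro A hA
      refine ⟨⋃ F ∈ zeroSet ⁻¹' A, F, ?_⟩
      ext x
      simp only [zeroSet, Set.mem_ofPred_eq, Set.mem_iUnion, Set.mem_sInter]
      constructor
      · intro h Z hZ
        obtain ⟨F, rfl⟩ := hA hZ
        exact fun p hp => h p ⟨F, hZ, hp⟩
      · rintro h p ⟨F, hF, hp⟩
        exact h _ hF p hp)
    (by
      rintro _ ⟨F, rfl⟩ _ ⟨G, rfl⟩
      refine ⟨{r | ∃ p ∈ F, ∃ q ∈ G, r = p * q}, ?_⟩
      ext x
      simp only [zeroSet, Set.mem_ofPred_eq, Set.mem_union]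
      constructor
      · intro h
        by_contra! hc
        obtain ⟨⟨p, hp, hp0⟩, q, hq, hq0⟩ := hc
        have := h _ ⟨p, hp, q, hq, rfl⟩
        rw [map_mul] at this
        exact (mul_ne_zero hp0 hq0) this
      · rintro (h | h) _ ⟨p, hp, q, hq, rfl⟩
        · simp [h p hp]
        · simp [h q hq])

/-- The irreducible components, as subsets of `gl(n)`, of `S ⊆ gl(n)` in the Zariski topology
(the subspace topology of `S`). -/
def zariskiComponents {n : ℕ} (S : Set (Mat n)) : Set (Set (Mat n)) :=
  letI : TopologicalSpace S := (zariski n).induced Subtype.val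
  (fun C : Set S => Subtype.val '' C) '' irreducibleComponents S

/-! ### The group `A` -/

/-- The gradient `(j+1) x_i ^ j` of `f_{i, j+1}` at `x`, an element of `gl(i) ⊆ gl(n)`. The
power is taken in `gl(i)`, so that for `j = 0` it is the identity matrix of `gl(i)`. -/
noncomputable def gzGrad {n : ℕ} (i : ℕ) (hi : i ≤ n) (j : ℕ) (x : Mat n) : Mat n :=
  ((j : ℂ) + 1) • embed n (proj i hi x ^ j)

/-- The flow `t · x = Ad (exp (t (j+1) x_i ^ j)) x`, which integrates (with time reversed) the
Hamiltonian vector field `x ↦ [x, ∇ f_{i, j+1}(x)]`. -/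
noncomputable def gzFlow {n : ℕ} (i : ℕ) (hi : i ≤ n) (j : ℕ) (t : ℂ) (x : Mat n) : Mat n :=
  NormedSpace.exp (t • gzGrad i hi j x) * x * (NormedSpace.exp (t • gzGrad i hi j x))⁻¹

/-- The projector onto the first `i` coordinates (the identity matrix of `gl(i) ⊆ gl(n)`). -/
def cornerOne (n i : ℕ) : Mat n := Matrix.diagonal fun a => if a.val < i then 1 else 0

theorem cornerOne_mul_cornerOne (n i k : ℕ) :
    cornerOne n i * cornerOne n k = cornerOne n (min i k) := by
  simp only [cornerOne, Matrix.diagonal_mul_diagonal]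
  congr 1
  funext a
  by_cases h1 : a.val < i <;> by_cases h2 : a.val < k <;> simp [h1, h2]

theorem embed_proj {n i : ℕ} (hi : i ≤ n) (x : Mat n) :
    embed n (proj i hi x) = cornerOne n i * x * cornerOne n i := by
  ext a b
  simp only [cornerOne, embed, proj, Matrix.diagonal_mul, Matrix.mul_diagonal]
  by_cases h1 : a.val < i <;> by_cases h2 : b.val < i <;> simp [h1, h2]
  rfl

theorem proj_embed {n i : ℕ} (hi : i ≤ n) (y : Mat i) : proj i hi (embed n y) = y := by
  ext a b
  change embed n y (Fin.castLE hi a) (Fin.castLE hi b) = y a b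
  simp [embed]

theorem embed_mul {n i : ℕ} (hi : i ≤ n) (y z : Mat i) :
    embed n (y * z) = embed n y * embed n z := by
  obtain ⟨m, rfl⟩ := Nat.exists_eq_add_of_le hi
  ext a b
  rw [Matrix.mul_apply, Fin.sum_univ_add]
  simp only [embed, Matrix.of_apply, Matrix.mul_apply]
  by_cases h1 : a.val < i <;> by_cases h2 : b.val < i <;> simp [h1, h2]

theorem embed_one (n i : ℕ) : embed n (1 : Mat i) = cornerOne n i := by
  ext a b
  simp only [embed, cornerOne, Matrix.of_apply, Matrix.diagonal_apply, Matrix.one_apply, Fin.ext_iff]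
  by_cases h1 : a.val < i <;> by_cases h2 : b.val < i <;> by_cases h3 : a.val = b.val <;>
    simp_all

theorem embed_pow {n i : ℕ} (hi : i ≤ n) (y : Mat i) (j : ℕ) :
    embed n (y ^ j) = cornerOne n i * embed n y ^ j := by
  induction j with
  | zero => simp [embed_one]
  | succ j ih => rw [pow_succ, embed_mul hi, ih, pow_succ, mul_assoc]

theorem gzGrad_eq {n i : ℕ} (hi : i ≤ n) (j : ℕ) (x : Mat n) :
    gzGrad i hi j x = ((j : ℂ) + 1) •
      (cornerOne n i * (cornerOne n i * x * cornerOne n i) ^ j) := by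
  rw [gzGrad, embed_pow hi, embed_proj]

theorem cornerOne_commute {n i k : ℕ} (hi : i ≤ n) (hik : i ≤ k) (j : ℕ) (x : Mat n) :
    Commute (gzGrad i hi j x) (cornerOne n k) := by
  have h1 : cornerOne n k * cornerOne n i = cornerOne n i := by
    rw [cornerOne_mul_cornerOne, min_eq_right hik]
  have h2 : cornerOne n i * cornerOne n k = cornerOne n i := by
    rw [cornerOne_mul_cornerOne, min_eq_left hik]
  have h3 : Commute (cornerOne n i) (cornerOne n k) := h2.trans h1.symm
  rw [gzGrad_eq]
  refine Commute.smul_left (h3.mul_left (Commute.pow_left ?_ j)) _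
  change _ * _ = _ * _
  rw [mul_assoc, h2, ← mul_assoc, ← mul_assoc, h1]

theorem corner_commute {n i : ℕ} (hi : i ≤ n) (j : ℕ) (x : Mat n) :
    Commute (gzGrad i hi j x) (cornerOne n i * x * cornerOne n i) := by
  have h : cornerOne n i * cornerOne n i = cornerOne n i := by
    rw [cornerOne_mul_cornerOne, min_self]
  rw [gzGrad_eq]
  refine Commute.smul_left (Commute.mul_left ?_ (Commute.pow_left (Commute.refl _) j)) _
  change _ * _ = _ * _
  rw [mul_assoc _ (cornerOne n i) (cornerOne n i), h, ← mul_assoc, ← mul_assoc, h]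

theorem conj_eq_of_commute {n : ℕ} {g y : Mat n} (hg : IsUnit g) (h : Commute g y) :
    g * y * g⁻¹ = y := by
  rw [h.eq, mul_assoc, Matrix.mul_nonsing_inv _ ((Matrix.isUnit_iff_isUnit_det _).1 hg), mul_one]

theorem corner_conj {n k : ℕ} {g : Mat n} (hg : IsUnit g) (h : Commute g (cornerOne n k))
    (x : Mat n) : cornerOne n k * (g * x * g⁻¹) * cornerOne n k =
      g * (cornerOne n k * x * cornerOne n k) * g⁻¹ := by
  have h' : Commute g⁻¹ (cornerOne n k) := by
    obtain ⟨u, rfl⟩ := hg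
    rw [← Matrix.coe_units_inv]
    exact h.units_inv_left
  calc _ = (cornerOne n k * g) * x * (g⁻¹ * cornerOne n k) := by simp only [mul_assoc]
    _ = _ := by rw [← h.eq, h'.eq]; simp only [mul_assoc]

theorem gzGrad_flow_of_le {n i k : ℕ} (hi : i ≤ n) (hk : k ≤ n) (hki : k ≤ i) (j l : ℕ)
    (t : ℂ) (x : Mat n) : gzGrad k hk l (gzFlow i hi j t x) = gzGrad k hk l x := by
  set g := NormedSpace.exp (t • gzGrad i hi j x) with hgdef
  have hg : IsUnit g := Matrix.isUnit_exp _
  have hP : Commute g (cornerOne n i) :=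
    (((cornerOne_commute hi le_rfl j x).smul_left t)).exp_left
  have hx : Commute g (cornerOne n i * x * cornerOne n i) :=
    ((corner_commute hi j x).smul_left t).exp_left
  have key : cornerOne n i * gzFlow i hi j t x * cornerOne n i =
      cornerOne n i * x * cornerOne n i := by
    rw [gzFlow, ← hgdef, corner_conj hg hP, conj_eq_of_commute hg hx]
  have h1 : cornerOne n k * cornerOne n i = cornerOne n k := by
    rw [cornerOne_mul_cornerOne, min_eq_left hki]
  have h2 : cornerOne n i * cornerOne n k = cornerOne n k := by
    rw [cornerOne_mul_cornerOne, min_eq_right hki]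
  have h3 : ∀ y : Mat n, cornerOne n k * y * cornerOne n k =
      cornerOne n k * (cornerOne n i * y * cornerOne n i) * cornerOne n k := fun y => by
    calc _ = (cornerOne n k * cornerOne n i) * y * (cornerOne n i * cornerOne n k) := by
          rw [h1, h2]
      _ = _ := by simp only [mul_assoc]
  rw [gzGrad_eq, gzGrad_eq, h3 (gzFlow i hi j t x), key, ← h3]

theorem gzGrad_conj {n k : ℕ} (hk : k ≤ n) (l : ℕ) {g : Mat n} (hg : IsUnit g)
    (h : Commute g (cornerOne n k)) (x : Mat n) :
    gzGrad k hk l (g * x * g⁻¹) = g * gzGrad k hk l x * g⁻¹ := by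
  rw [gzGrad_eq, gzGrad_eq, corner_conj hg h]
  obtain ⟨u, rfl⟩ := hg
  rw [← Matrix.coe_units_inv, Units.conj_pow, mul_smul_comm, smul_mul_assoc]
  congr 1
  simp only [← mul_assoc]
  rw [h.eq]

theorem gzFlow_comm_of_le {n i k : ℕ} (hi : i ≤ n) (hk : k ≤ n) (hik : i ≤ k) (j l : ℕ)
    (s t : ℂ) (x : Mat n) :
    gzFlow k hk l t (gzFlow i hi j s x) = gzFlow i hi j s (gzFlow k hk l t x) := by
  have e : gzFlow i hi j s (gzFlow k hk l t x) =
      NormedSpace.exp (s • gzGrad i hi j x) * gzFlow k hk l t x *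
        (NormedSpace.exp (s • gzGrad i hi j x))⁻¹ := by
    conv_lhs => rw [gzFlow]
    rw [gzGrad_flow_of_le hk hi hik]
  rw [e]
  set g := NormedSpace.exp (s • gzGrad i hi j x) with hgdef
  have hg : IsUnit g := Matrix.isUnit_exp _
  have hP : Commute g (cornerOne n k) := ((cornerOne_commute hi hik j x).smul_left s).exp_left
  have e2 : gzFlow i hi j s x = g * x * g⁻¹ := rfl
  rw [e2, gzFlow, gzFlow, gzGrad_conj hk l hg hP]
  have e3 : t • (g * gzGrad k hk l x * g⁻¹) = g * (t • gzGrad k hk l x) * g⁻¹ := by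
    rw [mul_smul_comm, smul_mul_assoc]
  rw [e3, Matrix.exp_conj _ _ hg]
  set h := NormedSpace.exp (t • gzGrad k hk l x) with hhdef
  have hu : IsUnit h := Matrix.isUnit_exp _
  obtain ⟨u, hu'⟩ := hg
  obtain ⟨v, hv'⟩ := hu
  rw [← hu', ← hv', ← Matrix.coe_units_inv, ← Matrix.coe_units_inv,
    ← Units.val_mul, ← Units.val_mul, ← Matrix.coe_units_inv]
  simp [mul_assoc]

theorem gzFlow_comm {n i k : ℕ} (hi : i ≤ n) (hk : k ≤ n) (j l : ℕ)
    (s t : ℂ) (x : Mat n) :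
    gzFlow k hk l t (gzFlow i hi j s x) = gzFlow i hi j s (gzFlow k hk l t x) := by
  rcases le_total i k with h | h
  · exact gzFlow_comm_of_le hi hk h j l s t x
  · exact (gzFlow_comm_of_le hk hi h l j t s x).symm

theorem gzFlow_zero {n i : ℕ} (hi : i ≤ n) (j : ℕ) (x : Mat n) : gzFlow i hi j 0 x = x := by
  simp [gzFlow]

theorem gzFlow_add {n i : ℕ} (hi : i ≤ n) (j : ℕ) (s t : ℂ) (x : Mat n) :
    gzFlow i hi j (s + t) x = gzFlow i hi j s (gzFlow i hi j t x) := by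
  have e : gzFlow i hi j s (gzFlow i hi j t x) =
      NormedSpace.exp (s • gzGrad i hi j x) * gzFlow i hi j t x *
        (NormedSpace.exp (s • gzGrad i hi j x))⁻¹ := by
    conv_lhs => rw [gzFlow]
    rw [gzGrad_flow_of_le hi hi le_rfl]
  rw [e, gzFlow, gzFlow, add_smul, Matrix.exp_add_of_commute _ _
    (((Commute.refl _).smul_left s).smul_right t), Matrix.mul_inv_rev]
  simp only [mul_assoc]

/-- The action of `ℂ` on `gl(n)` by the flow of the Hamiltonian vector field of `f_{i, j+1}`. -/
noncomputable def gzFlowHom {n : ℕ} (i : ℕ) (hi : i ≤ n) (j : ℕ) :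
    Multiplicative ℂ →* Equiv.Perm (Mat n) where
  toFun t :=
    { toFun := gzFlow i hi j t.toAdd
      invFun := gzFlow i hi j (-t.toAdd)
      left_inv := fun x => by rw [← gzFlow_add, neg_add_cancel, gzFlow_zero]
      right_inv := fun x => by rw [← gzFlow_add, add_neg_cancel, gzFlow_zero] }
  map_one' := by ext1 x; exact gzFlow_zero hi j x
  map_mul' s t := by ext1 x; exact gzFlow_add hi j s.toAdd t.toAdd x

/-- The group `A ≅ ℂ^{n(n-1)/2}`, with coordinates `t_{i, j+1}` at `⟨i, j⟩` for
`1 ≤ i ≤ n - 1` and `0 ≤ j < i` (there are none with `i = 0`), written multiplicatively. -/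
abbrev GroupA (n : ℕ) : Type := (Σ i : Fin n, Fin i.val) → Multiplicative ℂ

/-- The action of `A` on `gl(n)`: `(t_{i,j})` acts by the composition of the commuting flows
of the Hamiltonian vector fields of the `f_{i,j}` at the times `t_{i,j}`. -/
noncomputable def actionA (n : ℕ) : GroupA n →* Equiv.Perm (Mat n) :=
  MonoidHom.noncommPiCoprod
    (fun p : (Σ i : Fin n, Fin i.val) => gzFlowHom p.1.val p.1.isLt.le p.2.val)
    (fun _ _ _ _ _ => Equiv.ext fun _ => gzFlow_comm _ _ _ _ _ _ _)

/-- The orbit `A · x`. -/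
def orbitA {n : ℕ} (x : Mat n) : Set (Mat n) := {y | ∃ a : GroupA n, y = actionA n a x}

end GelfandZeitlin

namespace GelfandZeitlin
open scoped Matrix

/-! ### Regular nilpotent matrices -/

/-! A sequence of signs defines a linear order of the indices: each index b is placed after all
smaller ones or before all of them (`signOrder`). The matrices that are triangular for this order
form a Borel subalgebra (`triangular_isBorel`), the only one with the prescribed images in the
corners (`towerBorels_eq`). Its regular nilpotents are the strictly triangular matrices whose
entries at consecutive indices are all nonzero (`regNilpotents_triangular`), so every later
statement is about the explicit sets `regTriangular`.

Vanishing of the traces says that every corner is nilpotent (`kwMap_eq_zero_iff`). By nondegeneracy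
of the trace form, strong regularity says that the powers of the corners, embedded in the big
algebra, are independent (`isStronglyRegular_iff`). Write x as a corner N of size m + 1 bordered by
a column u, a row v and a scalar d. Nilpotency of x and N forces d = 0 and v N^k u = 0 for all k
(`lastRow_dotProduct_eq_zero`). If N^m killed both u and v, it would commute with x and so be a
polynomial in x, contrary to independence (`pow_mulVec_lastCol_ne_zero_or`). So u or v is cyclic for
N, the other one vanishes, and induction puts x into one of the Borel subalgebras
(`exists_mem_towerBorel`). Conversely, for a regular triangular matrix the last basis vector is
cyclic for x or for its transpose and is killed by the smaller corners, which proves independence by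
induction (`linearIndependent_of_regTriangular`).

Each piece is an open subset of a linear space, hence irreducible, and is cut out of the nilfiber by
the closed condition of lying in its Borel subalgebra, since the signs can be read off from a
regular element (`sign_eq_of_mem_regTriangular`). Thus the pieces are the components.

The flows conjugate by exponentials of elements of the Borel subalgebra, so they preserve each
piece. Transitivity is by induction on the size: lift flows to make the corners equal, then use the
flows of the powers of N, which fix N and move u by exponentials of multiples of N^j
(`mem_orbitA_of_proj_eq`). -/

theorem pow_eq_zero_of_isNilpotent {n : ℕ} {x : Mat n} (hx : IsNilpotent x) : x ^ n = 0 := by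
  have h := Matrix.isNilpotent_charpoly_sub_pow_of_isNilpotent hx
  rw [isNilpotent_iff_eq_zero, sub_eq_zero, Fintype.card_fin] at h
  have h2 := Matrix.aeval_self_charpoly x
  rwa [h, map_pow, Polynomial.aeval_X] at h2

theorem pow_mulVec_eq_zero_of_le {n : ℕ} {x : Mat n} {v : Fin n → ℂ} {k l : ℕ} (hkl : k ≤ l)
    (h : x ^ k *ᵥ v = 0) : x ^ l *ᵥ v = 0 := by
  obtain ⟨d, rfl⟩ := Nat.exists_eq_add_of_le hkl
  rw [add_comm, pow_add, ← Matrix.mulVec_mulVec, h, Matrix.mulVec_zero]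

/-- Multiply a relation by x^(m-i), where i is the least index with a nonzero coefficient: all later
terms die and a nonzero multiple of x^m v remains. -/
theorem linearIndependent_pow_mulVec {n m : ℕ} {x : Mat n} {v : Fin n → ℂ}
    (h0 : x ^ (m + 1) *ᵥ v = 0) (h1 : x ^ m *ᵥ v ≠ 0) :
    LinearIndependent ℂ fun j : Fin (m + 1) => x ^ j.val *ᵥ v := by
  rw [Fintype.linearIndependent_iff]
  intro g hg
  by_contra! hne
  obtain ⟨i, hi⟩ := hne
  obtain ⟨i, hi, hmin⟩ := WellFounded.has_min (wellFounded_lt (α := Fin (m + 1)))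
    {i | g i ≠ 0} ⟨i, hi⟩
  have h2 := congrArg (fun w => x ^ (m - i.val) *ᵥ w) hg
  simp only [Matrix.mulVec_sum, Matrix.mulVec_smul, Matrix.mulVec_mulVec, ← pow_add,
    Matrix.mulVec_zero] at h2
  rw [Finset.sum_eq_single i] at h2
  · have hi2 := i.isLt
    rw [Nat.sub_add_cancel (by omega)] at h2
    exact (smul_ne_zero hi h1) h2
  · intro j _ hji
    rcases lt_or_gt_of_ne hji with h | h
    · have : g j = 0 := by
        by_contra h3
        exact hmin j h3 h
      rw [this, zero_smul]
    · rw [pow_mulVec_eq_zero_of_le _ h0, smul_zero]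
      have : i.val < j.val := h
      omega
  · simp

theorem exists_eq_sum_pow_mulVec {m : ℕ} {x : Mat (m + 1)} {v : Fin (m + 1) → ℂ}
    (h0 : x ^ (m + 1) *ᵥ v = 0) (h1 : x ^ m *ᵥ v ≠ 0) (w : Fin (m + 1) → ℂ) :
    ∃ c : Fin (m + 1) → ℂ, w = ∑ j, c j • (x ^ j.val *ᵥ v) := by
  have hspan := (linearIndependent_pow_mulVec h0 h1).span_eq_top_of_card_eq_finrank (by simp)
  have hw : w ∈ Submodule.span ℂ (Set.range fun j : Fin (m + 1) => x ^ j.val *ᵥ v) := by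
    rw [hspan]; trivial
  obtain ⟨c, hc⟩ := (Submodule.mem_span_range_iff_exists_fun ℂ).1 hw
  exact ⟨c, hc.symm⟩

theorem exists_mulVec_ne_zero {n : ℕ} {x : Mat n} (hx : x ≠ 0) : ∃ v, x *ᵥ v ≠ 0 := by
  by_contra! h
  exact hx (Matrix.ext_of_mulVec_single fun i => by rw [h, Matrix.zero_mulVec])

/-- Any v not killed by x^m is cyclic, and a matrix commuting with x is determined by its value on a
cyclic vector. -/
theorem exists_eq_sum_pow_of_commute {m : ℕ} {x y : Mat (m + 1)} (hx : IsNilpotent x)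
    (h1 : x ^ m ≠ 0) (hy : x * y = y * x) :
    ∃ c : Fin (m + 1) → ℂ, y = ∑ j, c j • x ^ j.val := by
  obtain ⟨v, hv⟩ := exists_mulVec_ne_zero h1
  have h0 : x ^ (m + 1) *ᵥ v = 0 := by
    rw [pow_eq_zero_of_isNilpotent hx, Matrix.zero_mulVec]
  obtain ⟨c, hc⟩ := exists_eq_sum_pow_mulVec h0 hv (y *ᵥ v)
  refine ⟨c, ?_⟩
  have hc' : y *ᵥ v = (∑ j, c j • x ^ j.val) *ᵥ v := by
    rw [hc, Matrix.sum_mulVec]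
    simp only [Matrix.smul_mulVec]
  have hcomm : ∀ k, Commute (x ^ k) y := fun k => Commute.pow_left hy k
  have hcomm2 : ∀ k, Commute (x ^ k) (∑ j : Fin (m + 1), c j • x ^ j.val) := fun k =>
    Commute.sum_right _ _ _ fun j _ => (Commute.pow_pow (Commute.refl x) _ _).smul_right _
  refine Matrix.ext_of_mulVec_single fun i => ?_
  obtain ⟨d, hd⟩ := exists_eq_sum_pow_mulVec h0 hv (Pi.single i 1)
  rw [hd, Matrix.mulVec_sum, Matrix.mulVec_sum]
  refine Finset.sum_congr rfl fun k _ => ?_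
  rw [Matrix.mulVec_smul, Matrix.mulVec_smul, Matrix.mulVec_mulVec, Matrix.mulVec_mulVec,
    ← (hcomm k).eq, ← (hcomm2 k).eq, ← Matrix.mulVec_mulVec, ← Matrix.mulVec_mulVec, hc']

theorem linearIndependent_pow {m : ℕ} {x : Mat (m + 1)} (hx : IsNilpotent x) (h1 : x ^ m ≠ 0) :
    LinearIndependent ℂ fun j : Fin (m + 1) => x ^ j.val := by
  obtain ⟨v, hv⟩ := exists_mulVec_ne_zero h1
  have h0 : x ^ (m + 1) *ᵥ v = 0 := by
    rw [pow_eq_zero_of_isNilpotent hx, Matrix.zero_mulVec]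
  have := Fintype.linearIndependent_iff.1 (linearIndependent_pow_mulVec h0 hv)
  rw [Fintype.linearIndependent_iff]
  intro g hg
  refine this g ?_
  have h2 := congrArg (fun w => w *ᵥ v) hg
  simpa only [Matrix.sum_mulVec, Matrix.smul_mulVec, Matrix.zero_mulVec] using h2

theorem isRegularElt_of_pow_ne_zero {m : ℕ} {x : Mat (m + 1)} (hx : IsNilpotent x)
    (h1 : x ^ m ≠ 0) : IsRegularElt x := by
  have hker : LinearMap.ker (LieAlgebra.ad ℂ (Mat (m + 1)) x : Mat (m + 1) →ₗ[ℂ] Mat (m + 1)) =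
      Submodule.span ℂ (Set.range fun j : Fin (m + 1) => x ^ j.val) := by
    ext y
    rw [LinearMap.mem_ker, LieAlgebra.ad_apply, Ring.lie_def, sub_eq_zero,
      Submodule.mem_span_range_iff_exists_fun]
    constructor
    · intro h
      obtain ⟨c, hc⟩ := exists_eq_sum_pow_of_commute hx h1 h
      exact ⟨c, hc.symm⟩
    · rintro ⟨c, rfl⟩
      have h2 : Commute x (∑ j : Fin (m + 1), c j • x ^ j.val) :=
        Commute.sum_right _ _ _ fun j _ => ((Commute.refl x).pow_right j.val).smul_right (c j)
      exact h2.eq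
  rw [IsRegularElt, hker, finrank_span_eq_card (linearIndependent_pow hx h1), Fintype.card_fin]

/-! ### Exponentials of matrices -/

section exp
open scoped Nat

theorem hasSum_exp {n : ℕ} (A : Mat n) :
    HasSum (fun k : ℕ => (k !⁻¹ : ℂ) • A ^ k) (NormedSpace.exp A) := by
  let _ : NormedRing (Mat n) := Matrix.linftyOpNormedRing
  let _ : NormedAlgebra ℂ (Mat n) := Matrix.linftyOpNormedAlgebra
  exact NormedSpace.exp_series_hasSum_exp' A

/-- Termwise comparison of the two exponential series. Only linearity of f and g is required, so it
also applies to maps that are not ring homomorphisms, such as reading off a column. -/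
theorem map_exp_eq {n k : ℕ} {V : Type*} [AddCommGroup V] [Module ℂ V] [TopologicalSpace V]
    [T2Space V] [IsTopologicalAddGroup V] [ContinuousSMul ℂ V] (A : Mat n) (B : Mat k)
    (f : Mat n →ₗ[ℂ] V) (g : Mat k →ₗ[ℂ] V) (h : ∀ j, f (A ^ j) = g (B ^ j)) :
    f (NormedSpace.exp A) = g (NormedSpace.exp B) := by
  have hf := (hasSum_exp A).map f (LinearMap.continuous_of_finiteDimensional f)
  have hg := (hasSum_exp B).map g (LinearMap.continuous_of_finiteDimensional g)
  have e : (f ∘ fun j : ℕ => (j !⁻¹ : ℂ) • A ^ j) = g ∘ fun j : ℕ => (j !⁻¹ : ℂ) • B ^ j := by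
    funext j
    simp [h]
  rw [e] at hf
  exact hf.unique hg

/-- The tail of the series lies in the range of left multiplication by X², which is closed because
it is finite-dimensional. -/
theorem exp_eq_one_add_add {n : ℕ} (X : Mat n) :
    ∃ B : Mat n, NormedSpace.exp X = 1 + X + X ^ 2 * B := by
  have h := (hasSum_nat_add_iff' 2).2 (hasSum_exp X)
  let W : Submodule ℂ (Mat n) := LinearMap.range (LinearMap.mulLeft ℂ (X ^ 2))
  have hW : IsClosed (W : Set (Mat n)) := Submodule.closed_of_finiteDimensional W
  have hmem := hW.mem_of_tendsto h (Filter.Eventually.of_forall fun s =>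
    W.sum_mem fun i _ => W.smul_mem _ ⟨X ^ i, by simp [← pow_add, add_comm]⟩)
  obtain ⟨B, hB⟩ := hmem
  refine ⟨B, ?_⟩
  simp only [LinearMap.mulLeft_apply, Finset.sum_range_succ, Finset.sum_range_zero] at hB
  rw [hB]
  simp

theorem exp_mulVec_of_eigen {n : ℕ} {X : Mat n} {v : Fin n → ℂ} {c : ℂ} (h : X *ᵥ v = c • v) :
    NormedSpace.exp X *ᵥ v = Complex.exp c • v := by
  have h1 : ∀ j, X ^ j *ᵥ v = c ^ j • v := by
    intro j
    induction j with
    | zero => simp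
    | succ j ih => rw [pow_succ, ← Matrix.mulVec_mulVec, h, Matrix.mulVec_smul, ih, smul_smul,
        pow_succ, mul_comm]
  have h2 := (hasSum_exp X).map ((Matrix.mulVecBilin ℂ ℂ).flip v : Mat n →ₗ[ℂ] _)
    (LinearMap.continuous_of_finiteDimensional _)
  have h3 := (NormedSpace.exp_series_hasSum_exp' (𝕂 := ℂ) c).smul_const v
  rw [Complex.exp_eq_exp_ℂ]
  refine h2.unique ?_
  convert h3 using 2 with j
  simp [h1, smul_smul]

end exp

/-! ### Matrices that are triangular for a linear order of the indices -/

/-- The matrices that are upper triangular when the indices are ordered by `ρ`. -/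
def triangular {n : ℕ} (ρ : Fin n → ℤ) : LieSubalgebra ℂ (Mat n) where
  carrier := {x | ∀ a b, ρ b < ρ a → x a b = 0}
  add_mem' := fun {x y} hx hy a b h => by simp [hx a b h, hy a b h]
  zero_mem' := fun _ _ _ => rfl
  smul_mem' := fun c x hx a b h => by simp [hx a b h]
  lie_mem' := fun {x y} hx hy => by
    have h1 : Matrix.BlockTriangular x ρ := fun a b h => hx a b h
    have h2 : Matrix.BlockTriangular y ρ := fun a b h => hy a b h
    intro a b h
    rw [Ring.lie_def]
    exact ((h1.mul h2).sub (h2.mul h1)) h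

/-- `b` is the immediate successor of `a` in the order of the indices given by `ρ`. -/
def IsSuccessor {n : ℕ} (ρ : Fin n → ℤ) (a b : Fin n) : Prop :=
  ρ a < ρ b ∧ ∀ c, ρ a < ρ c → ρ b ≤ ρ c

/-- The strictly triangular matrices for the order `ρ` whose entries next to the diagonal
do not vanish. -/
def regTriangular {n : ℕ} (ρ : Fin n → ℤ) : Set (Mat n) :=
  {x | (∀ a b, ρ b ≤ ρ a → x a b = 0) ∧ ∀ a b, IsSuccessor ρ a b → x a b ≠ 0}

theorem exists_range_bound {n : ℕ} (ρ : Fin n → ℤ) : ∃ k : ℕ, ∀ a b, ρ b < ρ a + k := by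
  obtain ⟨M, hM⟩ := Set.Finite.bddAbove (Set.finite_range fun p : Fin n × Fin n => ρ p.2 - ρ p.1)
  refine ⟨M.toNat + 1, fun a b => ?_⟩
  have h : ρ b - ρ a ≤ M := hM ⟨(a, b), rfl⟩
  have := Int.self_le_toNat M
  push_cast
  omega

/-- The k-th derived algebra is supported on the entries with ρ b - ρ a ≥ k. In a bracket only the
diagonal terms at k = 0 could break the next bound, and these cancel because scalars commute. -/
theorem triangular_isSolvable {n : ℕ} {ρ : Fin n → ℤ} (hρ : Function.Injective ρ) :
    LieAlgebra.IsSolvable (triangular ρ) := by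
  have key : ∀ (k : ℕ) (y : triangular ρ), y ∈ LieAlgebra.derivedSeries ℂ (triangular ρ) k →
      ∀ a b, ρ b < ρ a + k → (y : Mat n) a b = 0 := by
    intro k
    induction k with
    | zero => intro y _ a b h; exact y.2 a b (by simpa using h)
    | succ k ih =>
      intro y hy
      rw [LieAlgebra.derivedSeries_def, LieAlgebra.derivedSeriesOfIdeal_succ,
        ← LieAlgebra.derivedSeries_def, ← LieSubmodule.mem_toSubmodule,
        LieSubmodule.lieIdeal_oper_eq_linear_span'] at hy
      induction hy using Submodule.span_induction with
      | zero => intro a b _; rfl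
      | add x y _ _ hx hy =>
        intro a b h
        change (x : Mat n) a b + (y : Mat n) a b = 0
        rw [hx a b h, hy a b h, add_zero]
      | smul c x _ hx =>
        intro a b h
        change c * (x : Mat n) a b = 0
        rw [hx a b h, mul_zero]
      | mem x hx =>
        obtain ⟨u, hu, v, hv, rfl⟩ := hx
        intro a b h
        have hu' := ih u hu
        have hv' := ih v hv
        rw [LieSubalgebra.coe_bracket, Ring.lie_def, Matrix.sub_apply, Matrix.mul_apply,
          Matrix.mul_apply, ← Finset.sum_sub_distrib]
        push_cast at h
        refine Finset.sum_eq_zero fun c _ => ?_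
        have e1 : ∀ p q : Mat n, (∀ a b, ρ b < ρ a + k → p a b = 0) →
            (∀ a b, ρ b < ρ a + k → q a b = 0) → (c ≠ a ∨ c ≠ b) → p a c * q c b = 0 := by
          intro p q hp hq hc
          by_cases h1 : ρ c < ρ a + k
          · rw [hp a c h1, zero_mul]
          by_cases h2 : ρ b < ρ c + k
          · rw [hq c b h2, mul_zero]
          exfalso
          have h3 : ρ c = ρ a := by omega
          have h4 : ρ c = ρ b := by omega
          exact hc.elim (fun h => h (hρ h3)) (fun h => h (hρ h4))
        by_cases hc : c ≠ a ∨ c ≠ b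
        · rw [e1 _ _ hu' hv' hc, e1 _ _ hv' hu' hc, sub_zero]
        · push Not at hc
          obtain ⟨rfl, rfl⟩ := hc
          ring
  obtain ⟨k, hk⟩ := exists_range_bound ρ
  refine LieAlgebra.IsSolvable.mk (R := ℂ) (k := k) ?_
  rw [eq_bot_iff]
  intro y hy
  rw [LieSubmodule.mem_bot]
  apply Subtype.ext
  ext a b
  exact key k y hy a b (hk a b)

theorem single_mem_triangular {n : ℕ} {ρ : Fin n → ℤ} {a b : Fin n} (h : ρ a ≤ ρ b) (c : ℂ) :
    Matrix.single a b c ∈ triangular ρ := by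
  intro i j hij
  refine Matrix.single_apply_of_ne _ _ _ _ _ ?_
  rintro ⟨rfl, rfl⟩
  omega

/-- The two matrix units and their bracket span a copy of sl(2), which is perfect and so survives in
every derived algebra. -/
theorem not_isSolvable_of_single_mem {n : ℕ} {c : LieSubalgebra ℂ (Mat n)} {a b : Fin n}
    (hab : a ≠ b) (h1 : Matrix.single a b (1 : ℂ) ∈ c) (h2 : Matrix.single b a (1 : ℂ) ∈ c)
    (hc : LieAlgebra.IsSolvable c) : False := by
  obtain ⟨k, hk⟩ := LieAlgebra.IsSolvable.solvable ℂ c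
  have e1 : ⁅Matrix.single a b (1 : ℂ), Matrix.single b a (1 : ℂ)⁆ =
      Matrix.single a a 1 - Matrix.single b b 1 := by
    simp [Ring.lie_def]
  have h3 : (Matrix.single a a 1 - Matrix.single b b 1 : Mat n) ∈ c := e1 ▸ c.lie_mem h1 h2
  have e2 : ⁅(Matrix.single a a 1 - Matrix.single b b 1 : Mat n), Matrix.single a b (1 : ℂ)⁆ =
      (2 : ℂ) • Matrix.single a b (1 : ℂ) := by
    simp [Ring.lie_def, sub_mul, mul_sub, hab.symm]
    rw [← Matrix.single_add]
    norm_num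
  have e3 : ⁅(Matrix.single a a 1 - Matrix.single b b 1 : Mat n), Matrix.single b a (1 : ℂ)⁆ =
      (-2 : ℂ) • Matrix.single b a (1 : ℂ) := by
    simp [Ring.lie_def, sub_mul, mul_sub, hab]
    ext i j
    simp [Matrix.single_apply]
    split_ifs <;> norm_num
  have key : ∀ k, (⟨_, h1⟩ : c) ∈ LieAlgebra.derivedSeries ℂ c k ∧
      (⟨_, h2⟩ : c) ∈ LieAlgebra.derivedSeries ℂ c k ∧
      (⟨_, h3⟩ : c) ∈ LieAlgebra.derivedSeries ℂ c k := by
    intro k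
    induction k with
    | zero => exact ⟨trivial, trivial, trivial⟩
    | succ k ih =>
      obtain ⟨i1, i2, i3⟩ := ih
      rw [LieAlgebra.derivedSeries_def, LieAlgebra.derivedSeriesOfIdeal_succ,
        ← LieAlgebra.derivedSeries_def]
      refine ⟨?_, ?_, ?_⟩
      · have h := SMulMemClass.smul_mem ((2 : ℂ)⁻¹) (LieSubmodule.lie_mem_lie i3 i1)
        convert h using 1
        apply Subtype.ext
        change _ = (2 : ℂ)⁻¹ • ⁅_, _⁆
        rw [e2, smul_smul]
        norm_num
      · have h := SMulMemClass.smul_mem ((-2 : ℂ)⁻¹) (LieSubmodule.lie_mem_lie i3 i2)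
        convert h using 1
        apply Subtype.ext
        change _ = (-2 : ℂ)⁻¹ • ⁅_, _⁆
        rw [e3, smul_smul]
        norm_num
      · have h := LieSubmodule.lie_mem_lie i1 i2
        convert h using 1
        apply Subtype.ext
        exact e1.symm
  have h := (key k).1
  rw [hk, LieSubmodule.mem_bot] at h
  have h' := congrFun (congrFun (congrArg Subtype.val h) a) b
  simp at h'

/-- A forbidden nonzero entry x a b in a larger solvable algebra is isolated by bracketing with two
diagonal units. What is left, apart from a multiple of the allowed unit at (b, a), is a multiple of
the unit at (a, b), and the two units generate sl(2). -/
theorem triangular_isBorel {n : ℕ} {ρ : Fin n → ℤ} (hρ : Function.Injective ρ) :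
    IsBorel (triangular ρ) := by
  refine ⟨triangular_isSolvable hρ, fun c hc hle x hx a b hab => ?_⟩
  by_contra hne
  have hneq : a ≠ b := by rintro rfl; omega
  have h1 : Matrix.single b a (1 : ℂ) ∈ c := hle (single_mem_triangular hab.le 1)
  have h2 : ⁅Matrix.single a a (1 : ℂ), ⁅Matrix.single b b (1 : ℂ), x⁆⁆ ∈ c :=
    c.lie_mem (hle (single_mem_triangular le_rfl 1))
      (c.lie_mem (hle (single_mem_triangular le_rfl 1)) hx)
  have e : ⁅Matrix.single a a (1 : ℂ), ⁅Matrix.single b b (1 : ℂ), x⁆⁆ =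
      -(x a b • Matrix.single a b (1 : ℂ)) - x b a • Matrix.single b a (1 : ℂ) := by
    simp only [Ring.lie_def, mul_sub, sub_mul, ← mul_assoc, Matrix.single_mul_single_of_ne _ _ _ _ hneq,
      zero_mul]
    simp only [mul_assoc, Matrix.single_mul_single_of_ne _ _ _ _ hneq.symm, mul_zero]
    simp only [← mul_assoc, Matrix.single_mul_mul_single]
    simp
  rw [e] at h2
  have h3 := c.smul_mem (-(x a b)⁻¹) (c.add_mem h2 (c.smul_mem (x b a) h1))
  rw [sub_add_cancel, smul_neg, neg_smul, neg_neg, smul_smul, inv_mul_cancel₀ hne, one_smul] at h3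
  exact not_isSolvable_of_single_mem hneq h3 h1 hc

theorem mul_apply_self_of_triangular {n : ℕ} {ρ : Fin n → ℤ} (hρ : Function.Injective ρ)
    {x y : Mat n} (hx : x ∈ triangular ρ) (hy : y ∈ triangular ρ) (a : Fin n) :
    (x * y) a a = x a a * y a a := by
  rw [Matrix.mul_apply, Finset.sum_eq_single a]
  · intro c _ hc
    rcases lt_or_gt_of_ne (fun h => hc (hρ h) : ρ c ≠ ρ a) with h | h
    · rw [hx a c h, zero_mul]
    · rw [hy c a h, mul_zero]
  · simp

theorem apply_self_eq_zero_of_isNilpotent {n : ℕ} {ρ : Fin n → ℤ} (hρ : Function.Injective ρ)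
    {x : Mat n} (hx : x ∈ triangular ρ) (hn : IsNilpotent x) (a : Fin n) : x a a = 0 := by
  have h1 : ∀ k, (x ^ k) a a = x a a ^ k := by
    intro k
    induction k with
    | zero => simp
    | succ k ih =>
      have h : x ^ k ∈ triangular ρ := by
        have h : Matrix.BlockTriangular x ρ := fun a b h => hx a b h
        exact fun a b hab => h.pow k hab
      rw [pow_succ, mul_apply_self_of_triangular hρ h hx, ih, pow_succ]
  obtain ⟨k, hk⟩ := hn
  have := h1 k
  rw [hk, Matrix.zero_apply] at this
  exact eq_zero_of_pow_eq_zero this.symm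

theorem isNilpotent_of_strict {n : ℕ} {ρ : Fin n → ℤ} {x : Mat n}
    (hx : ∀ a b, ρ b ≤ ρ a → x a b = 0) : IsNilpotent x := by
  have h1 : ∀ k : ℕ, ∀ a b, ρ b < ρ a + k → (x ^ k) a b = 0 := by
    intro k
    induction k with
    | zero =>
      intro a b h
      rw [pow_zero, Matrix.one_apply_ne]
      rintro rfl
      simp at h
    | succ k ih =>
      intro a b h
      rw [pow_succ, Matrix.mul_apply]
      refine Finset.sum_eq_zero fun c _ => ?_
      by_cases h1 : ρ c < ρ a + k
      · rw [ih a c h1, zero_mul]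
      · rw [hx c b, mul_zero]
        push_cast at h
        omega
  obtain ⟨k, hk⟩ := exists_range_bound ρ
  exact ⟨k, by ext a b; exact h1 k a b (hk a b)⟩

/-- If the entry at a consecutive pair vanished, ad x would map the Borel subalgebra into its
subspace with zero diagonal and zero (a, b) entry. That subspace has codimension n + 1, so rank and
nullity would give a centralizer of dimension at least n + 1. -/
theorem apply_ne_zero_of_isRegularElt {n : ℕ} {ρ : Fin n → ℤ} (hρ : Function.Injective ρ)
    {x : Mat n} (hx : ∀ a b, ρ b ≤ ρ a → x a b = 0) (hreg : IsRegularElt x) {a b : Fin n}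
    (hab : IsSuccessor ρ a b) : x a b ≠ 0 := by
  intro h0
  let V : Submodule ℂ (Mat n) := (triangular ρ).toSubmodule
  let ad : Mat n →ₗ[ℂ] Mat n := LieAlgebra.ad ℂ (Mat n) x
  let A : V →ₗ[ℂ] Mat n := ad.domRestrict V
  let φ : V →ₗ[ℂ] (Fin n → ℂ) × ℂ :=
    { toFun := fun y => (fun i => (y : Mat n) i i, (y : Mat n) a b)
      map_add' := fun _ _ => rfl
      map_smul' := fun _ _ => rfl }
  have hφ : Function.Surjective φ := by
    rintro ⟨d, t⟩
    have hne : a ≠ b := by rintro rfl; exact lt_irrefl _ hab.1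
    refine ⟨⟨Matrix.diagonal d + Matrix.single a b t, ?_⟩, ?_⟩
    · refine (triangular ρ).add_mem ?_ (single_mem_triangular hab.1.le t)
      intro i j hij
      exact Matrix.diagonal_apply_ne _ (by rintro rfl; omega)
    · refine Prod.ext (funext fun i => ?_) ?_
      · change Matrix.diagonal d i i + Matrix.single a b t i i = d i
        rw [Matrix.diagonal_apply_eq, Matrix.single_apply_of_ne, add_zero]
        rintro ⟨rfl, h⟩
        exact hne h.symm
      · change Matrix.diagonal d a b + Matrix.single a b t a b = t
        rw [Matrix.diagonal_apply_ne _ hne, Matrix.single_apply_same, zero_add]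
  have hrange : LinearMap.range A ≤ (LinearMap.ker φ).map V.subtype := by
    rintro _ ⟨y, rfl⟩
    have hy : ∀ a b, ρ b < ρ a → (y : Mat n) a b = 0 := y.2
    have hx' : x ∈ triangular ρ := fun a b h => hx a b h.le
    have hA : A y = x * (y : Mat n) - (y : Mat n) * x := by
      rw [← Ring.lie_def]; rfl
    have hV : A y ∈ V := (triangular ρ).lie_mem hx' y.2
    refine ⟨⟨A y, hV⟩, ?_, rfl⟩
    refine LinearMap.mem_ker.2 (Prod.ext (funext fun i => ?_) ?_)
    · change A y i i = 0
      rw [hA, Matrix.sub_apply, mul_apply_self_of_triangular hρ hx' y.2,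
        mul_apply_self_of_triangular hρ y.2 hx', mul_comm, sub_self]
    · change A y a b = 0
      rw [hA, Matrix.sub_apply, Matrix.mul_apply, Matrix.mul_apply, Finset.sum_eq_zero,
        Finset.sum_eq_zero, sub_zero]
      · intro c _
        rcases lt_trichotomy (ρ c) (ρ a) with h | h | h
        · rw [hy a c h, zero_mul]
        · rw [hρ h, h0, mul_zero]
        · rw [hx c b (hab.2 c h), mul_zero]
      · intro c _
        rcases le_or_gt (ρ c) (ρ a) with h | h
        · rw [hx a c h, zero_mul]
        · rcases (hab.2 c h).lt_or_eq with h' | h'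
          · rw [hy c b h', mul_zero]
          · rw [← hρ h', h0, zero_mul]
  have d1 := LinearMap.finrank_range_add_finrank_ker A
  have d2 := LinearMap.finrank_range_add_finrank_ker φ
  have d3 := Submodule.finrank_mono hrange
  have d4 : Module.finrank ℂ ((LinearMap.ker φ).map V.subtype) = Module.finrank ℂ (LinearMap.ker φ) :=
    Submodule.finrank_map_subtype_eq V _
  have d5 : Module.finrank ℂ ((LinearMap.ker A).map V.subtype) = Module.finrank ℂ (LinearMap.ker A) :=
    Submodule.finrank_map_subtype_eq V _
  have d6 : (LinearMap.ker A).map V.subtype ≤ LinearMap.ker ad := by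
    rintro _ ⟨y, hy, rfl⟩
    exact hy
  have d7 := Submodule.finrank_mono d6
  have d8 : Module.finrank ℂ (LinearMap.ker ad) = n := hreg
  rw [LinearMap.range_eq_top.2 hφ, finrank_top, Module.finrank_prod, Module.finrank_fin_fun,
    Module.finrank_self] at d2
  omega

/-- Applying x moves the highest nonzero coordinate of w to its immediate predecessor, multiplied by
a nonzero entry. The number k of lower positions is how often this can be repeated. -/
theorem pow_mulVec_ne_zero_of_regTriangular {n : ℕ} {ρ : Fin n → ℤ} (hρ : Function.Injective ρ)
    {x : Mat n} (hx : x ∈ regTriangular ρ) (k : ℕ) (w : Fin n → ℂ) (a : Fin n) (ha : w a ≠ 0)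
    (hw : ∀ c, ρ a < ρ c → w c = 0) (hk : (Finset.univ.filter fun c => ρ c < ρ a).card = k) :
    x ^ k *ᵥ w ≠ 0 := by
  induction k generalizing w a with
  | zero =>
    rw [pow_zero, Matrix.one_mulVec]
    exact fun h => ha (congrFun h a)
  | succ k ih =>
    have hne : (Finset.univ.filter fun c => ρ c < ρ a).Nonempty := by
      rw [← Finset.card_pos, hk]; omega
    obtain ⟨p, hp, hmax⟩ := Finset.exists_max_image _ ρ hne
    simp only [Finset.mem_filter, Finset.mem_univ, true_and] at hp hmax
    have hsucc : IsSuccessor ρ p a := by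
      refine ⟨hp, fun c hc => ?_⟩
      by_contra! h
      exact absurd (hmax c h) (not_le.2 hc)
    rw [pow_succ, ← Matrix.mulVec_mulVec]
    refine ih (x *ᵥ w) p ?_ ?_ ?_
    · rw [Matrix.mulVec, dotProduct, Finset.sum_eq_single a]
      · exact mul_ne_zero (hx.2 p a hsucc) ha
      · intro c _ hca
        rcases lt_or_ge (ρ a) (ρ c) with h | h
        · rw [hw c h, mul_zero]
        · rw [hx.1 p c, zero_mul]
          exact hmax c (lt_of_le_of_ne h fun h => hca (hρ h))
      · simp
    · intro c hc
      rw [Matrix.mulVec, dotProduct]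
      refine Finset.sum_eq_zero fun d _ => ?_
      rcases lt_or_ge (ρ a) (ρ d) with h | h
      · rw [hw d h, mul_zero]
      · rw [hx.1 c d (h.trans (hsucc.2 c hc)), zero_mul]
    · have e : (Finset.univ.filter fun c => ρ c < ρ p) =
          (Finset.univ.filter fun c => ρ c < ρ a).erase p := by
        ext c
        simp only [Finset.mem_filter, Finset.mem_univ, true_and, Finset.mem_erase]
        constructor
        · intro h
          exact ⟨by rintro rfl; exact lt_irrefl _ h, h.trans hp⟩
        · rintro ⟨h1, h2⟩
          exact lt_of_le_of_ne (hmax c h2) fun h => h1 (hρ h)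
      rw [e, Finset.card_erase_of_mem (by simpa using hp), hk, Nat.add_sub_cancel]

theorem pow_mulVec_single_ne_zero {m : ℕ} {ρ : Fin (m + 1) → ℤ} (hρ : Function.Injective ρ)
    {x : Mat (m + 1)} (hx : x ∈ regTriangular ρ) {a : Fin (m + 1)} (ha : ∀ c, ρ c ≤ ρ a) :
    x ^ m *ᵥ Pi.single a 1 ≠ 0 := by
  refine pow_mulVec_ne_zero_of_regTriangular hρ hx m _ a (by simp) ?_ ?_
  · intro c hc
    exact absurd (ha c) (not_le.2 hc)
  · have : (Finset.univ.filter fun c => ρ c < ρ a) = Finset.univ.erase a := by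
      ext c
      simp only [Finset.mem_filter, Finset.mem_univ, true_and, Finset.mem_erase, and_true]
      exact ⟨by rintro h rfl; exact lt_irrefl _ h, fun h => lt_of_le_of_ne (ha c) fun h' => h (hρ h')⟩
    rw [this, Finset.card_erase_of_mem (Finset.mem_univ _)]
    simp

theorem regNilpotents_triangular {n : ℕ} {ρ : Fin n → ℤ} (hρ : Function.Injective ρ) :
    regNilpotents (triangular ρ) = regTriangular ρ := by
  ext x
  constructor
  · rintro ⟨hx, hn, hreg⟩
    have h : ∀ a b, ρ b ≤ ρ a → x a b = 0 := by
      intro a b hab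
      rcases hab.lt_or_eq with h | h
      · exact hx a b h
      · rw [hρ h]; exact apply_self_eq_zero_of_isNilpotent hρ hx hn a
    exact ⟨h, fun a b hab => apply_ne_zero_of_isRegularElt hρ h hreg hab⟩
  · intro hx
    have hn := isNilpotent_of_strict hx.1
    refine ⟨fun a b h => hx.1 a b h.le, hn, ?_⟩
    rcases n with _ | m
    · exact Module.finrank_zero_of_subsingleton
    · obtain ⟨a, -, ha⟩ := Finset.exists_max_image Finset.univ ρ Finset.univ_nonempty
      refine isRegularElt_of_pow_ne_zero hn fun h => ?_
      refine pow_mulVec_single_ne_zero hρ hx (a := a) (fun c => ha c (Finset.mem_univ c)) ?_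
      rw [h, Matrix.zero_mulVec]

/-! ### The orders of the indices given by sequences of signs -/

/-- The order of `Fin n` in which `b` comes after all `a < b` if `S b` holds, and before all
`a < b` otherwise. -/
def signOrder (S : ℕ → Bool) (n : ℕ) (b : Fin n) : ℤ := if S b.val then b.val else -b.val

theorem signOrder_injective (S : ℕ → Bool) (n : ℕ) : Function.Injective (signOrder S n) := by
  intro a b h
  apply Fin.ext
  unfold signOrder at h
  split_ifs at h <;> omega

theorem signOrder_lt_of_lt {S : ℕ → Bool} {n : ℕ} {a b : Fin n} (hb : S b.val = true)
    (h : a < b) : signOrder S n a < signOrder S n b := by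
  have : a.val < b.val := h
  unfold signOrder
  rw [if_pos hb]
  split_ifs <;> omega

theorem signOrder_gt_of_lt {S : ℕ → Bool} {n : ℕ} {a b : Fin n} (hb : S b.val = false)
    (h : a < b) : signOrder S n b < signOrder S n a := by
  have : a.val < b.val := h
  simp only [signOrder, hb, Bool.false_eq_true, if_false]
  split_ifs <;> omega

theorem signOrder_not (S : ℕ → Bool) (n : ℕ) :
    signOrder (fun b => !S b) n = fun a => -signOrder S n a := by
  funext a
  cases h : S a.val <;> simp [signOrder, h]

/-- The Borel subalgebra attached to a sequence of signs. -/
def towerBorel (S : ℕ → Bool) (n : ℕ) : LieSubalgebra ℂ (Mat n) := triangular (signOrder S n)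

theorem map_proj_towerBorel (S : ℕ → Bool) {n i : ℕ} (hi : i ≤ n) :
    (towerBorel S n).toSubmodule.map (proj i hi) = (towerBorel S i).toSubmodule := by
  ext y
  constructor
  · rintro ⟨x, hx, rfl⟩
    exact fun a b h => hx (Fin.castLE hi a) (Fin.castLE hi b) h
  · intro hy
    refine ⟨embed n y, fun a b h => ?_, proj_embed hi y⟩
    simp only [embed, Matrix.of_apply]
    split_ifs with h1
    · exact hy _ _ h
    · rfl

/-! ### Conjugation by `K` -/

theorem mem_conjSubalgebra {i : ℕ} {k : GL (Fin i) ℂ} {b : LieSubalgebra ℂ (Mat i)} {x : Mat i} :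
    x ∈ conjSubalgebra k b ↔ (k : Mat i)⁻¹ * x * (k : Mat i) ∈ b := by
  have h1 : (k : Mat i) * (k : Mat i)⁻¹ = 1 := by
    rw [← Matrix.coe_units_inv, ← Units.val_mul, mul_inv_cancel, Units.val_one]
  have h2 : (k : Mat i)⁻¹ * (k : Mat i) = 1 := by
    rw [← Matrix.coe_units_inv, ← Units.val_mul, inv_mul_cancel, Units.val_one]
  rw [conjSubalgebra, LieSubalgebra.mem_map]
  constructor
  · rintro ⟨y, hy, rfl⟩
    change (k : Mat i)⁻¹ * ((k : Mat i).lieConj k.invertible y) * (k : Mat i) ∈ b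
    rw [Matrix.lieConj_apply]
    have : (k : Mat i)⁻¹ * ((k : Mat i) * y * (k : Mat i)⁻¹) * (k : Mat i) =
      ((k : Mat i)⁻¹ * (k : Mat i)) * y * ((k : Mat i)⁻¹ * (k : Mat i)) := by
      simp only [mul_assoc]
    rwa [this, h2, one_mul, mul_one]
  · intro h
    refine ⟨_, h, ?_⟩
    change (k : Mat i).lieConj k.invertible _ = x
    rw [Matrix.lieConj_apply]
    have : (k : Mat i) * ((k : Mat i)⁻¹ * x * (k : Mat i)) * (k : Mat i)⁻¹ =
      ((k : Mat i) * (k : Mat i)⁻¹) * x * ((k : Mat i) * (k : Mat i)⁻¹) := by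
      simp only [mul_assoc]
    rw [this, h1, one_mul, mul_one]

/-- Commuting with the corner projector lets the conditions on the last row and column, stated with
that projector, pass through conjugation by K. -/
theorem InK.commute {i : ℕ} {k : GL (Fin (i + 1)) ℂ} (hk : InK k) :
    Commute (k : Mat (i + 1)) (cornerOne (i + 1) i) := by
  change _ * _ = _ * _
  ext a b
  simp only [cornerOne, Matrix.mul_diagonal, Matrix.diagonal_mul]
  by_cases h : (a.val + 1 = i + 1 ↔ b.val + 1 = i + 1)
  · have ha := a.isLt
    have hb := b.isLt
    have : a.val < i ↔ b.val < i := by omega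
    simp only [this]
    ring
  · rw [hk a b h, zero_mul, mul_zero]

theorem commute_inv {n : ℕ} {k : GL (Fin n) ℂ} {P : Mat n} (h : Commute (k : Mat n) P) :
    Commute (k : Mat n)⁻¹ P := by
  rw [← Matrix.coe_units_inv]
  exact h.units_inv_left

/-- The matrices with vanishing last row, except for its last entry. -/
def lastRowZero (i : ℕ) : Set (Mat (i + 1)) :=
  {z | cornerOne (i + 1) i * z * cornerOne (i + 1) i = z * cornerOne (i + 1) i}

/-- The matrices with vanishing last column, except for its last entry. -/
def lastColZero (i : ℕ) : Set (Mat (i + 1)) :=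
  {z | cornerOne (i + 1) i * z * cornerOne (i + 1) i = cornerOne (i + 1) i * z}

theorem mem_lastRowZero {i : ℕ} {z : Mat (i + 1)} :
    z ∈ lastRowZero i ↔ ∀ a b : Fin (i + 1), ¬ a.val < i → b.val < i → z a b = 0 := by
  simp only [lastRowZero, Set.mem_ofPred_eq, ← Matrix.ext_iff, cornerOne, Matrix.mul_diagonal,
    Matrix.diagonal_mul]
  refine forall₂_congr fun a b => ?_
  by_cases h1 : a.val < i <;> by_cases h2 : b.val < i <;> simp [h1, h2, eq_comm]

theorem mem_lastColZero {i : ℕ} {z : Mat (i + 1)} :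
    z ∈ lastColZero i ↔ ∀ a b : Fin (i + 1), a.val < i → ¬ b.val < i → z a b = 0 := by
  simp only [lastColZero, Set.mem_ofPred_eq, ← Matrix.ext_iff, cornerOne, Matrix.mul_diagonal,
    Matrix.diagonal_mul]
  refine forall₂_congr fun a b => ?_
  by_cases h1 : a.val < i <;> by_cases h2 : b.val < i <;> simp [h1, h2, eq_comm]

theorem mul_cornerOne_eq_zero {i : ℕ} {z : Mat (i + 1)} :
    z * cornerOne (i + 1) i = 0 ↔ ∀ a b : Fin (i + 1), b.val < i → z a b = 0 := by
  simp only [← Matrix.ext_iff, cornerOne, Matrix.mul_diagonal]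
  refine forall₂_congr fun a b => ?_
  by_cases h2 : b.val < i <;> simp [h2]

theorem cornerOne_mul_eq_zero {i : ℕ} {z : Mat (i + 1)} :
    cornerOne (i + 1) i * z = 0 ↔ ∀ a b : Fin (i + 1), a.val < i → z a b = 0 := by
  simp only [← Matrix.ext_iff, cornerOne, Matrix.diagonal_mul]
  refine forall₂_congr fun a b => ?_
  by_cases h2 : a.val < i <;> simp [h2]

theorem cornerOne_mul_mul_eq_zero {i : ℕ} {z : Mat (i + 1)}
    (hz : proj i (Nat.le_succ i) z = 0) : cornerOne (i + 1) i * z * cornerOne (i + 1) i = 0 := by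
  rw [← embed_proj (Nat.le_succ i), hz]
  ext a b
  simp [embed]

/-- On matrices whose last row vanishes off the diagonal, the kernel of the projection to the corner
consists of the matrices supported in the last column. A subspace containing this kernel is
determined by its image. -/
theorem eq_of_map_proj_eq_of_lastRowZero {i : ℕ} {c t : Submodule ℂ (Mat (i + 1))}
    (hc : ∀ z ∈ c, z ∈ lastRowZero i) (ht : ∀ z ∈ t, z ∈ lastRowZero i)
    (hc' : ∀ z, z * cornerOne (i + 1) i = 0 → z ∈ c)
    (ht' : ∀ z, z * cornerOne (i + 1) i = 0 → z ∈ t)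
    (h : c.map (proj i (Nat.le_succ i)) = t.map (proj i (Nat.le_succ i))) : c = t := by
  have key : ∀ x y : Mat (i + 1), x ∈ lastRowZero i → y ∈ lastRowZero i →
      proj i (Nat.le_succ i) x = proj i (Nat.le_succ i) y →
      (y - x) * cornerOne (i + 1) i = 0 := by
    intro x y hx hy hxy
    rw [← cornerOne_mul_mul_eq_zero (z := y - x) (by rw [map_sub, hxy, sub_self]), mul_sub, sub_mul,
      sub_mul, hx, hy]
  refine le_antisymm (fun x hx => ?_) (fun x hx => ?_)
  · obtain ⟨y, hy, hxy⟩ : proj i (Nat.le_succ i) x ∈ t.map (proj i (Nat.le_succ i)) :=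
      h ▸ Submodule.mem_map_of_mem hx
    have := t.add_mem (ht' _ (key y x (ht y hy) (hc x hx) hxy)) hy
    rwa [sub_add_cancel] at this
  · obtain ⟨y, hy, hxy⟩ : proj i (Nat.le_succ i) x ∈ c.map (proj i (Nat.le_succ i)) :=
      h ▸ Submodule.mem_map_of_mem hx
    have := c.add_mem (hc' _ (key y x (hc y hy) (ht x hx) hxy)) hy
    rwa [sub_add_cancel] at this

theorem eq_of_map_proj_eq_of_lastColZero {i : ℕ} {c t : Submodule ℂ (Mat (i + 1))}
    (hc : ∀ z ∈ c, z ∈ lastColZero i) (ht : ∀ z ∈ t, z ∈ lastColZero i)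
    (hc' : ∀ z, cornerOne (i + 1) i * z = 0 → z ∈ c)
    (ht' : ∀ z, cornerOne (i + 1) i * z = 0 → z ∈ t)
    (h : c.map (proj i (Nat.le_succ i)) = t.map (proj i (Nat.le_succ i))) : c = t := by
  have key : ∀ x y : Mat (i + 1), x ∈ lastColZero i → y ∈ lastColZero i →
      proj i (Nat.le_succ i) x = proj i (Nat.le_succ i) y →
      cornerOne (i + 1) i * (y - x) = 0 := by
    intro x y hx hy hxy
    rw [← cornerOne_mul_mul_eq_zero (z := y - x) (by rw [map_sub, hxy, sub_self]), mul_sub, sub_mul,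
      hx, hy]
  refine le_antisymm (fun x hx => ?_) (fun x hx => ?_)
  · obtain ⟨y, hy, hxy⟩ : proj i (Nat.le_succ i) x ∈ t.map (proj i (Nat.le_succ i)) :=
      h ▸ Submodule.mem_map_of_mem hx
    have := t.add_mem (ht' _ (key y x (ht y hy) (hc x hx) hxy)) hy
    rwa [sub_add_cancel] at this
  · obtain ⟨y, hy, hxy⟩ : proj i (Nat.le_succ i) x ∈ c.map (proj i (Nat.le_succ i)) :=
      h ▸ Submodule.mem_map_of_mem hx
    have := c.add_mem (hc' _ (key y x (hc y hy) (ht x hx) hxy)) hy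
    rwa [sub_add_cancel] at this

theorem conj_mem_lastRowZero {i : ℕ} {k : GL (Fin (i + 1)) ℂ} (hk : InK k) {z : Mat (i + 1)}
    (hz : (k : Mat (i + 1))⁻¹ * z * (k : Mat (i + 1)) ∈ lastRowZero i) : z ∈ lastRowZero i := by
  have h1 := hk.commute
  have h2 := commute_inv h1
  set P := cornerOne (i + 1) i with hP
  set g : Mat (i + 1) := (k : Mat (i + 1)) with hg
  have hu : IsUnit g.det := (Matrix.isUnit_iff_isUnit_det _).1 k.isUnit
  have e1 : g * (P * (g⁻¹ * z * g) * P) * g⁻¹ = P * z * P := by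
    calc _ = (g * P) * g⁻¹ * z * (g * P) * g⁻¹ := by simp only [mul_assoc]
      _ = P * (g * g⁻¹) * z * P * (g * g⁻¹) := by rw [h1.eq]; simp only [mul_assoc]
      _ = _ := by rw [Matrix.mul_nonsing_inv _ hu, mul_one, mul_one]
  have e2 : g * ((g⁻¹ * z * g) * P) * g⁻¹ = z * P := by
    calc _ = (g * g⁻¹) * z * (g * P) * g⁻¹ := by simp only [mul_assoc]
      _ = (g * g⁻¹) * z * P * (g * g⁻¹) := by rw [h1.eq]; simp only [mul_assoc]
      _ = _ := by rw [Matrix.mul_nonsing_inv _ hu, mul_one, one_mul]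
  change P * z * P = z * P
  rw [← e1, ← e2]
  exact congrArg (fun w => g * w * g⁻¹) hz

theorem conj_mem_lastColZero {i : ℕ} {k : GL (Fin (i + 1)) ℂ} (hk : InK k) {z : Mat (i + 1)}
    (hz : (k : Mat (i + 1))⁻¹ * z * (k : Mat (i + 1)) ∈ lastColZero i) : z ∈ lastColZero i := by
  have h1 := hk.commute
  set P := cornerOne (i + 1) i with hP
  set g : Mat (i + 1) := (k : Mat (i + 1)) with hg
  have hu : IsUnit g.det := (Matrix.isUnit_iff_isUnit_det _).1 k.isUnit
  have e1 : g * (P * (g⁻¹ * z * g) * P) * g⁻¹ = P * z * P := by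
    calc _ = (g * P) * g⁻¹ * z * (g * P) * g⁻¹ := by simp only [mul_assoc]
      _ = P * (g * g⁻¹) * z * P * (g * g⁻¹) := by rw [h1.eq]; simp only [mul_assoc]
      _ = _ := by rw [Matrix.mul_nonsing_inv _ hu, mul_one, mul_one]
  have e2 : g * (P * (g⁻¹ * z * g)) * g⁻¹ = P * z := by
    calc _ = (g * P) * g⁻¹ * z * (g * g⁻¹) := by simp only [mul_assoc]
      _ = P * (g * g⁻¹) * z * (g * g⁻¹) := by rw [h1.eq]; simp only [mul_assoc]
      _ = _ := by rw [Matrix.mul_nonsing_inv _ hu, mul_one, mul_one]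
  change P * z * P = P * z
  rw [← e1, ← e2]
  exact congrArg (fun w => g * w * g⁻¹) hz

/-- The inductive step of uniqueness: every member of the orbit lies in the same maximal parabolic
and contains the kernel of its projection to the corner, so its image there determines it. -/
theorem eq_towerBorel_of_mem_orbitQ {S : ℕ → Bool} {i : ℕ} {c : LieSubalgebra ℂ (Mat (i + 1))}
    (hc : c ∈ orbitQ (i + 1) (S i))
    (h : c.toSubmodule.map (proj i (Nat.le_succ i)) = (towerBorel S i).toSubmodule) :
    c.toSubmodule = (towerBorel S (i + 1)).toSubmodule := by
  obtain ⟨k, hk, rfl⟩ := hc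
  rw [← map_proj_towerBorel S (Nat.le_succ i)] at h
  cases hS : S i with
  | true =>
    simp only [hS] at h ⊢
    refine eq_of_map_proj_eq_of_lastRowZero ?_ ?_ ?_ ?_ h
    · intro z hz
      refine conj_mem_lastRowZero hk (mem_lastRowZero.2 fun a b ha hb => ?_)
      exact mem_conjSubalgebra.1 hz a b (Fin.lt_def.2 (by omega))
    · intro z hz
      refine mem_lastRowZero.2 fun a b ha hb => hz a b ?_
      have := a.isLt
      exact signOrder_lt_of_lt (by rw [show a.val = i by omega, hS]) (Fin.lt_def.2 (by omega))
    · intro z hz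
      refine mem_conjSubalgebra.2 fun a b hab => ?_
      refine mul_cornerOne_eq_zero.1 ?_ a b ?_
      · rw [mul_assoc, hk.commute.eq, ← mul_assoc, mul_assoc _ z, hz, mul_zero, zero_mul]
      · have := a.isLt
        have := Fin.lt_def.1 hab
        omega
    · intro z hz a b hab
      refine mul_cornerOne_eq_zero.1 hz a b ?_
      by_contra hb
      have h1 := a.isLt
      have h2 := b.isLt
      rcases eq_or_ne a b with rfl | hne
      · exact lt_irrefl _ hab
      · have h3 : a.val ≠ b.val := fun h => hne (Fin.ext h)
        have h4 : a < b := Fin.lt_def.2 (by omega)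
        exact lt_asymm hab (signOrder_lt_of_lt (by rw [show b.val = i by omega, hS]) h4)
  | false =>
    simp only [hS] at h ⊢
    refine eq_of_map_proj_eq_of_lastColZero ?_ ?_ ?_ ?_ h
    · intro z hz
      refine conj_mem_lastColZero hk (mem_lastColZero.2 fun a b ha hb => ?_)
      exact mem_conjSubalgebra.1 hz a b (Fin.lt_def.2 (by omega))
    · intro z hz
      refine mem_lastColZero.2 fun a b ha hb => hz a b ?_
      have := b.isLt
      exact signOrder_gt_of_lt (by rw [show b.val = i by omega, hS]) (Fin.lt_def.2 (by omega))
    · intro z hz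
      refine mem_conjSubalgebra.2 fun a b hab => ?_
      refine cornerOne_mul_eq_zero.1 ?_ a b ?_
      · rw [← mul_assoc, ← mul_assoc, ← (commute_inv hk.commute).eq, mul_assoc _ _ z, hz, mul_zero,
          zero_mul]
      · have := b.isLt
        have := Fin.lt_def.1 hab
        omega
    · intro z hz a b hab
      refine cornerOne_mul_eq_zero.1 hz a b ?_
      by_contra hb
      have h1 := a.isLt
      have h2 := b.isLt
      rcases eq_or_ne a b with rfl | hne
      · exact lt_irrefl _ hab
      · have h3 : a.val ≠ b.val := fun h => hne (Fin.ext h)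
        have h4 : b < a := Fin.lt_def.2 (by omega)
        exact lt_asymm hab (signOrder_gt_of_lt (by rw [show a.val = i by omega, hS]) h4)

/-! ### Permutation matrices -/

/-- A permutation matrix that fixes the last index is block diagonal, so reordering the smaller
indices stays within a K-orbit. -/
theorem exists_inK_conj_perm {i : ℕ} (σ : Equiv.Perm (Fin (i + 1)))
    (hσ : σ (Fin.last i) = Fin.last i) :
    ∃ k : GL (Fin (i + 1)) ℂ, InK k ∧ ∀ (b : LieSubalgebra ℂ (Mat (i + 1))) (x : Mat (i + 1)),
      x ∈ conjSubalgebra k b ↔ x.submatrix σ σ ∈ b := by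
  let p : Equiv.Perm (Fin (i + 1)) → Mat (i + 1) := fun τ => τ.permMatrix ℂ
  have hmul : ∀ τ : Equiv.Perm (Fin (i + 1)), p τ * p τ⁻¹ = 1 := by
    intro τ
    change p τ * (τ⁻¹ : Equiv.Perm _).toPEquiv.toMatrix = 1
    rw [PEquiv.mul_toMatrix_toPEquiv]
    ext a b
    simp [p, PEquiv.toMatrix_apply, Matrix.one_apply, Equiv.Perm.inv_def]
  -- The inverse permutation appears because membership in the conjugate is tested on k⁻¹ x k.
  let k : GL (Fin (i + 1)) ℂ :=
    ⟨p σ⁻¹, p σ, by simpa using hmul σ⁻¹, hmul σ⟩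
  refine ⟨k, ?_, fun b x => ?_⟩
  · intro a b hab
    change p σ⁻¹ a b = 0
    have : σ⁻¹ a ≠ b := by
      rintro rfl
      apply hab
      have h1 : ∀ c : Fin (i + 1), c.val + 1 = i + 1 ↔ c = Fin.last i := fun c => by
        rw [Fin.ext_iff, Fin.val_last]; omega
      rw [h1, h1, Equiv.Perm.inv_eq_iff_eq, hσ]
    simp only [p, Equiv.Perm.permMatrix, PEquiv.toMatrix_apply, Equiv.toPEquiv_apply,
      Option.mem_def, Option.some.injEq, this, if_false]
  · rw [mem_conjSubalgebra, ← Matrix.coe_units_inv]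
    change p σ * x * p σ⁻¹ ∈ b ↔ _
    have : p σ * x * p σ⁻¹ = x.submatrix σ σ := by
      change σ.toPEquiv.toMatrix * x * (σ⁻¹ : Equiv.Perm _).toPEquiv.toMatrix = _
      rw [PEquiv.mul_toMatrix_toPEquiv, PEquiv.toMatrix_toPEquiv_mul]
      rfl
    rw [this]

theorem exists_perm_strictMono {i : ℕ} {ρ : Fin (i + 1) → ℤ} (hρ : Function.Injective ρ)
    (hlast : ∀ c, ρ c ≤ ρ (Fin.last i)) :
    ∃ σ : Equiv.Perm (Fin (i + 1)), σ (Fin.last i) = Fin.last i ∧ StrictMono (ρ ∘ σ) := by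
  have h : StrictMono (ρ ∘ Tuple.sort ρ) :=
    (Tuple.monotone_sort ρ).strictMono_of_injective (hρ.comp (Tuple.sort ρ).injective)
  refine ⟨Tuple.sort ρ, ?_, h⟩
  obtain ⟨c, hc⟩ := (Tuple.sort ρ).surjective (Fin.last i)
  have h1 : ρ (Tuple.sort ρ (Fin.last i)) = ρ (Fin.last i) := by
    refine le_antisymm (hlast _) ?_
    have := (Tuple.monotone_sort ρ) (Fin.le_last c)
    simpa [hc] using this
  exact hρ h1

theorem signOrder_le_last {S : ℕ → Bool} {i : ℕ} (hS : S i = true) (c : Fin (i + 1)) :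
    signOrder S (i + 1) c ≤ signOrder S (i + 1) (Fin.last i) := by
  rcases (Fin.le_last c).lt_or_eq with h | h
  · exact (signOrder_lt_of_lt hS h).le
  · rw [h]

/-- Sorting the order by a permutation makes it the standard one. A positive last sign makes the
last index the greatest, so sorting fixes it; for a negative sign the reversed order is sorted
instead, which gives lower triangular matrices. -/
theorem towerBorel_mem_orbitQ (S : ℕ → Bool) (i : ℕ) :
    towerBorel S (i + 1) ∈ orbitQ (i + 1) (S i) := by
  cases hS : S i with
  | true =>
    obtain ⟨σ, hσ, hmono⟩ := exists_perm_strictMono (signOrder_injective S (i + 1))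
      (signOrder_le_last hS)
    obtain ⟨k, hk, hmem⟩ := exists_inK_conj_perm σ hσ
    refine ⟨k, hk, ?_⟩
    ext x
    rw [hmem, if_pos rfl]
    constructor
    · exact fun hx a b hab => hx _ _ (hmono hab)
    · intro hx a b hab
      have := hx (σ.symm a) (σ.symm b) (hmono.lt_iff_lt.1 (by simpa using hab))
      simpa using this
  | false =>
    obtain ⟨σ, hσ, hmono⟩ := exists_perm_strictMono (signOrder_injective (fun b => !S b) (i + 1))
      (signOrder_le_last (by simp [hS]))
    obtain ⟨k, hk, hmem⟩ := exists_inK_conj_perm σ hσ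
    refine ⟨k, hk, ?_⟩
    rw [signOrder_not] at hmono
    ext x
    rw [hmem, if_neg (by simp)]
    constructor
    · intro hx a b hab
      exact hx _ _ (neg_lt_neg_iff.1 (hmono hab))
    · intro hx a b hab
      have := hx (σ.symm a) (σ.symm b) (hmono.lt_iff_lt.1 (by simpa using hab))
      simpa using this

/-! ### The Borel subalgebras with prescribed images in the corners -/

theorem towerBorel_isBorel (S : ℕ → Bool) (n : ℕ) : IsBorel (towerBorel S n) :=
  triangular_isBorel (signOrder_injective S n)

theorem towerBorel_one (S : ℕ → Bool) : towerBorel S 1 = ⊤ := by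
  refine eq_top_iff.2 fun x _ a b h => ?_
  rw [Subsingleton.elim a b] at h
  exact absurd h (lt_irrefl _)

theorem one_mem_of_mem_orbitQ {i : ℕ} {s : Bool} {c : LieSubalgebra ℂ (Mat i)}
    (hc : c ∈ orbitQ i s) : (1 : Mat i) ∈ c := by
  obtain ⟨k, -, rfl⟩ := hc
  rw [mem_conjSubalgebra, mul_one,
    Matrix.nonsing_inv_mul _ ((Matrix.isUnit_iff_isUnit_det _).1 k.isUnit)]
  cases s
  · exact fun a b h => Matrix.one_apply_ne (by rintro rfl; exact lt_irrefl _ h)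
  · exact fun a b h => Matrix.one_apply_ne (by rintro rfl; exact lt_irrefl _ h)

theorem towerBorels_eq {n : ℕ} (hn : 1 ≤ n) {S : ℕ → Bool} {s : Fin (n - 1) → Bool}
    (hS : ∀ m, S (m.val + 1) = s m) : towerBorels s = {towerBorel S n} := by
  refine Set.eq_singleton_iff_unique_mem.2 ⟨⟨towerBorel_isBorel S n, fun m => ?_⟩, ?_⟩
  · refine ⟨towerBorel S (m.val + 2), ?_, (map_proj_towerBorel S _).symm⟩
    rw [← hS]
    exact towerBorel_mem_orbitQ S (m.val + 1)
  rintro b ⟨hb, h⟩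
  rcases hn.lt_or_eq with hn | rfl
  · have key : ∀ j (hj : j + 1 ≤ n),
        b.toSubmodule.map (proj (j + 1) hj) = (towerBorel S (j + 1)).toSubmodule := by
      intro j
      induction j with
      | zero =>
        intro hj
        obtain ⟨c, hc, hcb⟩ := h ⟨0, by omega⟩
        -- No orbit is prescribed in gl(1). The image there is everything because the image in gl(2)
        -- contains the identity.
        obtain ⟨x, hx, hx1⟩ : (1 : Mat 2) ∈ b.toSubmodule.map (proj 2 hn) :=
          hcb ▸ one_mem_of_mem_orbitQ hc
        have : Subsingleton (Fin (0 + 1)) := inferInstanceAs (Subsingleton (Fin 1))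
        rw [towerBorel_one]
        refine eq_top_iff.2 fun y _ => ⟨y 0 0 • x, b.smul_mem _ hx, ?_⟩
        have e : proj 1 hj x = 1 := by
          change proj 1 (by omega) (proj 2 hn x) = 1
          rw [hx1]
          ext a b
          rw [Subsingleton.elim a 0, Subsingleton.elim b 0]
          rfl
        rw [map_smul]
        change _ • proj 1 hj x = y
        rw [e]
        ext a b
        rw [Subsingleton.elim a 0, Subsingleton.elim b 0]
        simp
      | succ j ih =>
        intro hj
        obtain ⟨c, hc, hcb⟩ := h ⟨j, by omega⟩
        change c ∈ orbitQ (j + 1 + 1) _ at hc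
        rw [← hS] at hc
        rw [← eq_towerBorel_of_mem_orbitQ (S := S) hc, hcb]
        rw [hcb, ← ih (by omega), ← Submodule.map_comp]
        rfl
    obtain ⟨j, rfl⟩ : ∃ j, n = j + 1 := ⟨n - 1, by omega⟩
    have h1 := key j le_rfl
    have h2 : proj (j + 1) le_rfl = (LinearMap.id : Mat (j + 1) →ₗ[ℂ] Mat (j + 1)) := rfl
    rw [h2, Submodule.map_id] at h1
    exact LieSubalgebra.toSubmodule_injective h1
  -- For n = 1 there are no orbit conditions, and maximality alone gives the whole algebra.
  · have h1 : b ≤ towerBorel S 1 := by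
      rw [towerBorel_one]; exact le_top
    exact le_antisymm h1 (hb.2 (towerBorel_isBorel S 1).1 h1)

/-! ### Traces of powers and nilpotency -/

theorem eq_zero_of_isIdempotentElem_of_trace_eq_zero {n : ℕ} {E : Mat n} (h : IsIdempotentElem E)
    (ht : Matrix.trace E = 0) : E = 0 := by
  have h1 : IsIdempotentElem (Matrix.toLin' E) := by
    change Matrix.toLin' E ∘ₗ Matrix.toLin' E = _
    rw [← Matrix.toLin'_mul, h.eq]
  have h2 := LinearMap.IsIdempotentElem.eq_zero_of_trace_eq_zero h1
    (by rw [Matrix.trace_toLin'_eq, ht])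
  exact (LinearEquiv.map_eq_zero_iff Matrix.toLin').1 h2

/-- Split the characteristic polynomial as X^r q with q prime to X. The Bézout identity yields a
polynomial e divisible by X with e(x) the idempotent projecting onto the invertible part of x. Its
trace is zero, so it is zero, and x^(r+1) = x^(r+1) e(x) vanishes. -/
theorem isNilpotent_of_trace_pow_eq_zero {n : ℕ} {x : Mat n}
    (h : ∀ j < n, Matrix.trace (x ^ (j + 1)) = 0) : IsNilpotent x := by
  rcases Nat.eq_zero_or_pos n with rfl | hn
  · exact ⟨1, Subsingleton.elim _ _⟩
  -- Reducing q modulo the characteristic polynomial leaves degree below n, so only the traces in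
  -- the hypothesis occur.
  open Polynomial in
  have htr : ∀ q : ℂ[X], Matrix.trace (x * aeval x q) = 0 := by
    intro q
    have hm := Matrix.charpoly_monic x
    have hd : x.charpoly.natDegree = n := by simp [Matrix.charpoly_natDegree_eq_dim]
    have h1 : (q %ₘ x.charpoly).natDegree < n := by
      conv_rhs => rw [← hd]
      exact natDegree_modByMonic_lt _ hm (fun h => by rw [h, natDegree_one] at hd; omega)
    rw [← aeval_modByMonic_eq_self_of_root (Matrix.aeval_self_charpoly x),
      aeval_eq_sum_range' h1, Finset.mul_sum, Matrix.trace_sum]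
    refine Finset.sum_eq_zero fun j hj => ?_
    rw [mul_smul_comm, Matrix.trace_smul, ← pow_succ', h j (Finset.mem_range.1 hj), smul_zero]
  obtain ⟨r, q, hq, hnd⟩ : ∃ (r : ℕ) (q : Polynomial ℂ),
      x.charpoly = Polynomial.X ^ r * q ∧ ¬ Polynomial.X ∣ q := by
    obtain ⟨q, hq, hnd⟩ := Polynomial.exists_eq_pow_rootMultiplicity_mul_and_not_dvd x.charpoly
      (Matrix.charpoly_monic x).ne_zero 0
    rw [Polynomial.C_0, sub_zero] at hq hnd
    exact ⟨_, q, hq, hnd⟩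
  obtain ⟨a, b, hab⟩ : IsCoprime (Polynomial.X ^ (r + 1)) q :=
    ((Polynomial.prime_X.irreducible.coprime_iff_not_dvd).2 hnd).pow_left
  have hp : ∀ f : Polynomial ℂ, Polynomial.aeval x (f * x.charpoly) = 0 := fun f => by
    rw [map_mul, Matrix.aeval_self_charpoly, mul_zero]
  obtain ⟨e, he⟩ : ∃ e, e = a * Polynomial.X ^ (r + 1) := ⟨_, rfl⟩
  have he1 : e * e - e = -(a * b * Polynomial.X) * x.charpoly := by
    rw [hq, he]
    linear_combination (a * Polynomial.X ^ (r + 1)) * hab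
  have he2 : e = Polynomial.X * (a * Polynomial.X ^ r) := by rw [he]; ring
  have he3 : Polynomial.X ^ (r + 1) = Polynomial.X ^ (r + 1) * e +
      b * Polynomial.X * x.charpoly := by
    rw [hq, he]
    linear_combination -(Polynomial.X ^ (r + 1)) * hab
  have hE : Polynomial.aeval x e = 0 := by
    refine eq_zero_of_isIdempotentElem_of_trace_eq_zero ?_ ?_
    · have h2 := congrArg (Polynomial.aeval x) he1
      rw [hp, map_sub, map_mul, sub_eq_zero] at h2
      exact h2
    · rw [he2, map_mul, Polynomial.aeval_X]
      exact htr _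
  refine ⟨r + 1, ?_⟩
  have h2 := congrArg (Polynomial.aeval x) he3
  rw [map_add, hp, map_mul, hE, mul_zero, zero_add, map_pow, Polynomial.aeval_X] at h2
  exact h2

/-! ### Strong regularity -/

theorem trace_embed {n i : ℕ} (hi : i ≤ n) (y : Mat i) :
    Matrix.trace (embed n y) = Matrix.trace y := by
  obtain ⟨m, rfl⟩ := Nat.exists_eq_add_of_le hi
  rw [Matrix.trace, Fin.sum_univ_add]
  simp [embed, Matrix.trace]

theorem trace_embed_mul {n i : ℕ} (hi : i ≤ n) (y : Mat i) (x : Mat n) :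
    Matrix.trace (embed n y * x) = Matrix.trace (y * proj i hi x) := by
  have h : cornerOne n i * embed n y * cornerOne n i = embed n y := by
    rw [← embed_proj hi, proj_embed hi]
  have h2 : cornerOne n i * cornerOne n i = cornerOne n i := by
    rw [cornerOne_mul_cornerOne, min_self]
  have h3 : embed n y * cornerOne n i = embed n y := by
    rw [← h, mul_assoc, h2]
  have h4 : cornerOne n i * embed n y = embed n y := by
    rw [← h, ← mul_assoc, ← mul_assoc, h2]
  rw [← trace_embed hi, embed_mul hi, embed_proj hi, ← mul_assoc, ← mul_assoc, h3,
    Matrix.trace_mul_comm (embed n y * x), ← mul_assoc, h4]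

theorem exists_hasFDerivAt_pow {R : Type*} [NormedRing R] [NormedAlgebra ℂ R] (k : ℕ) (z : R) :
    ∃ D : R →L[ℂ] R, HasFDerivAt (fun y : R => y ^ (k + 1)) D z ∧
      ∀ y, D y = ∑ j ∈ Finset.range (k + 1), z ^ (k - j) * (y * z ^ j) := by
  refine ⟨_, hasFDerivAt_pow' (𝕜 := ℂ) (k + 1) (x := z), fun y => ?_⟩
  simp [sum_apply, mul_assoc]

/-- The derivative of a power is a sum of k + 1 noncommuting products, which all have the same trace
by cyclicity. -/
theorem hasFDerivAt_trace_pow {i : ℕ} (k : ℕ) (z : Mat i) :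
    HasFDerivAt (fun y : Mat i => Matrix.trace (y ^ (k + 1)))
      (LinearMap.toContinuousLinearMap (((k : ℂ) + 1) •
        (Matrix.traceLinearMap (Fin i) ℂ ℂ ∘ₗ LinearMap.mulLeft ℂ (z ^ k)))) z := by
  let _ : NormedRing (Mat i) := Matrix.linftyOpNormedRing
  let _ : NormedAlgebra ℂ (Mat i) := Matrix.linftyOpNormedAlgebra
  obtain ⟨D, h1, hD⟩ : ∃ D : Mat i →L[ℂ] Mat i, HasFDerivAt (fun y : Mat i => y ^ (k + 1)) D z ∧
      ∀ y, D y = ∑ j ∈ Finset.range (k + 1), z ^ (k - j) * (y * z ^ j) := by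
    exact exists_hasFDerivAt_pow k z
  have h2 := (LinearMap.toContinuousLinearMap
    (Matrix.traceLinearMap (Fin i) ℂ ℂ)).hasFDerivAt.comp z h1
  refine h2.congr_fderiv ?_
  apply ContinuousLinearMap.ext
  intro y
  have h3 : ∀ j ∈ Finset.range (k + 1),
      Matrix.trace (z ^ (k - j) * (y * z ^ j)) = Matrix.trace (z ^ k * y) := by
    intro j hj
    rw [← mul_assoc, Matrix.trace_mul_comm, ← mul_assoc, ← pow_add,
      Nat.add_sub_cancel' (Nat.lt_succ_iff.1 (Finset.mem_range.1 hj))]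
  change Matrix.trace (D y) = ((k : ℂ) + 1) * Matrix.trace (z ^ k * y)
  rw [hD, Matrix.trace_sum, Finset.sum_congr rfl h3]
  simp

theorem fderiv_kwMap_apply {n : ℕ} (x y : Mat n) (p : Σ i : Fin (n + 1), Fin i.val) :
    fderiv ℂ (fun y : Mat n => kwMap y p) x y =
      Matrix.trace (gzGrad p.1.val (Nat.le_of_lt_succ p.1.isLt) p.2.val x * y) := by
  have hi := Nat.le_of_lt_succ p.1.isLt
  let _ : NormedAddCommGroup (Mat n) := Matrix.normedAddCommGroup
  let _ : NormedSpace ℂ (Mat n) := Matrix.normedSpace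
  let _ : NormedAddCommGroup (Mat p.1.val) := Matrix.normedAddCommGroup
  let _ : NormedSpace ℂ (Mat p.1.val) := Matrix.normedSpace
  have h1 := (hasFDerivAt_trace_pow p.2.val (proj p.1.val hi x)).comp x
    (LinearMap.toContinuousLinearMap (proj p.1.val hi)).hasFDerivAt
  have h2 : fderiv ℂ (fun y : Mat n => kwMap y p) x = _ := h1.fderiv
  rw [h2, gzGrad, smul_mul_assoc, Matrix.trace_smul, trace_embed_mul hi]
  rfl

/-- The nondegenerate trace form turns differentials into gradients, and the nonzero factors j + 1
do not affect independence. -/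
theorem isStronglyRegular_iff {n : ℕ} {x : Mat n} : IsStronglyRegular x ↔
    LinearIndependent ℂ fun p : (Σ i : Fin (n + 1), Fin i.val) =>
      embed n (proj p.1.val (Nat.le_of_lt_succ p.1.isLt) x ^ p.2.val) := by
  let T : Mat n →ₗ[ℂ] (Mat n →L[ℂ] ℂ) :=
    LinearMap.toContinuousLinearMap.toLinearMap ∘ₗ
      (LinearMap.llcomp ℂ (Mat n) (Mat n) ℂ (Matrix.traceLinearMap (Fin n) ℂ ℂ)) ∘ₗ
        LinearMap.mul ℂ (Mat n)
  have hT : ∀ M y, T M y = Matrix.trace (M * y) := fun _ _ => rfl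
  have hker : LinearMap.ker T = ⊥ := by
    rw [LinearMap.ker_eq_bot']
    intro M hM
    rw [Matrix.ext_iff_trace_mul_right]
    intro y
    rw [← hT, hM, zero_mul, Matrix.trace_zero]
    rfl
  have h1 : (fun p : (Σ i : Fin (n + 1), Fin i.val) =>
      fderiv ℂ (fun y : Mat n => kwMap y p) x) = T ∘ fun p : (Σ i : Fin (n + 1), Fin i.val) =>
        gzGrad p.1.val (Nat.le_of_lt_succ p.1.isLt) p.2.val x := by
    funext p
    ext1 y
    exact fderiv_kwMap_apply x y p
  rw [IsStronglyRegular, h1, LinearMap.linearIndependent_iff T hker]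
  have h2 := LinearIndependent.units_smul_iff
    (fun p : (Σ i : Fin (n + 1), Fin i.val) =>
      embed n (proj p.1.val (Nat.le_of_lt_succ p.1.isLt) x ^ p.2.val))
    (fun p => Units.mk0 ((p.2.val : ℂ) + 1) (Nat.cast_add_one_ne_zero _))
  exact h2

/-! ### The strongly regular nilfiber -/

theorem kwMap_eq_zero_iff {n : ℕ} {x : Mat n} :
    kwMap x = 0 ↔ ∀ i (hi : i ≤ n), IsNilpotent (proj i hi x) := by
  constructor
  · intro h i hi
    refine isNilpotent_of_trace_pow_eq_zero fun j hj => ?_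
    exact congrFun h ⟨⟨i, Nat.lt_succ_of_le hi⟩, ⟨j, hj⟩⟩
  · intro h
    funext p
    have h1 := h p.1.val (Nat.le_of_lt_succ p.1.isLt)
    exact (Matrix.isNilpotent_trace_of_isNilpotent (h1.pow_succ p.2.val)).eq_zero

theorem mem_nilfiberSreg_iff {n : ℕ} {x : Mat n} : x ∈ nilfiberSreg n ↔
    (∀ i (hi : i ≤ n), IsNilpotent (proj i hi x)) ∧
      LinearIndependent ℂ fun p : (Σ i : Fin (n + 1), Fin i.val) =>
        embed n (proj p.1.val (Nat.le_of_lt_succ p.1.isLt) x ^ p.2.val) := by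
  rw [nilfiberSreg, Set.mem_ofPred_eq, kwMap_eq_zero_iff, isStronglyRegular_iff]

theorem embed_self {n : ℕ} (y : Mat n) : embed n y = y := by
  ext a b
  simp [embed]

/-- The functions of the smaller corners form a subfamily whose gradients live in the corner; this
is what permits induction on the size. -/
theorem proj_mem_nilfiberSreg {n : ℕ} {x : Mat (n + 1)} (hx : x ∈ nilfiberSreg (n + 1)) :
    proj n (Nat.le_succ n) x ∈ nilfiberSreg n := by
  rw [mem_nilfiberSreg_iff] at hx ⊢
  refine ⟨fun i hi => hx.1 i (hi.trans (Nat.le_succ n)), ?_⟩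
  let ι : (Σ i : Fin (n + 1), Fin i.val) → (Σ i : Fin (n + 2), Fin i.val) :=
    fun p => ⟨p.1.castSucc, p.2⟩
  have hι : Function.Injective ι := by
    rintro ⟨i, j⟩ ⟨i', j'⟩ h
    simp only [ι, Sigma.mk.injEq] at h
    obtain ⟨h1, h2⟩ := h
    obtain rfl := Fin.castSucc_injective _ h1
    rw [eq_of_heq h2]
  have h := hx.2.comp ι hι
  rw [Fintype.linearIndependent_iff] at h ⊢
  intro g hg
  refine h g ?_
  have h2 : embed (n + 1) (∑ p : (Σ i : Fin (n + 1), Fin i.val), g p •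
      embed n (proj p.1.val (Nat.le_of_lt_succ p.1.isLt) (proj n (Nat.le_succ n) x) ^ p.2.val)) =
        0 := by
    rw [hg]; ext a b; simp [embed]
  rw [← h2]
  ext a b
  simp only [embed, Matrix.sum_apply, Matrix.smul_apply, Matrix.of_apply, Function.comp_apply, ι]
  split_ifs with hab
  · rfl
  · refine Finset.sum_eq_zero fun p _ => ?_
    rw [dif_neg, smul_zero]
    rintro ⟨h3, h4⟩
    have := p.1.isLt
    simp only [Fin.val_castSucc] at h3 h4
    omega

theorem pow_ne_zero_of_mem_nilfiberSreg {m : ℕ} {x : Mat (m + 1)}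
    (hx : x ∈ nilfiberSreg (m + 1)) : x ^ m ≠ 0 := by
  have h := (mem_nilfiberSreg_iff.1 hx).2.ne_zero ⟨Fin.last (m + 1), Fin.last m⟩
  change embed (m + 1) (x ^ m : Mat (m + 1)) ≠ 0 at h
  rwa [embed_self] at h

theorem isNilpotent_of_mem_nilfiberSreg {n : ℕ} {x : Mat n} (hx : x ∈ nilfiberSreg n) :
    IsNilpotent x := (mem_nilfiberSreg_iff.1 hx).1 n le_rfl

/-! ### Bordering a nilpotent corner by a row and a column -/

/-- The last column of `x` without its last entry. -/
def lastCol {n : ℕ} (x : Mat (n + 1)) : Fin n → ℂ := fun a => x a.castSucc (Fin.last n)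

/-- The last row of `x` without its last entry. -/
def lastRow {n : ℕ} (x : Mat (n + 1)) : Fin n → ℂ := fun a => x (Fin.last n) a.castSucc

/-- The expression is det(1 - w x), expanded by the Schur complement with det(1 - w N) = 1. A zero
would produce a vector z with last coordinate 1 and x (w z) = z, impossible for nilpotent x. -/
theorem one_sub_mul_ne_zero_of_isNilpotent {n : ℕ} {x : Mat (n + 1)} (hx : IsNilpotent x)
    (hN : IsNilpotent (proj n (Nat.le_succ n) x)) (w : ℂ) :
    1 - w * x (Fin.last n) (Fin.last n) - ∑ k ∈ Finset.range n,
      w ^ (k + 2) * (lastRow x ⬝ᵥ (proj n (Nat.le_succ n) x ^ k *ᵥ lastCol x)) ≠ 0 := by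
  intro h0
  set N := proj n (Nat.le_succ n) x with hNdef
  -- The solution of (1 - w N) p = w u by the geometric series, finite since N is nilpotent; the
  -- fixed vector is then (p, 1).
  let p : Fin n → ℂ := ∑ k ∈ Finset.range n, w ^ (k + 1) • (N ^ k *ᵥ lastCol x)
  have hp : w • (N *ᵥ p + lastCol x) = p := by
    have e1 : w • (N *ᵥ p) =
        ∑ k ∈ Finset.range n, w ^ (k + 1 + 1) • (N ^ (k + 1) *ᵥ lastCol x) := by
      simp only [p, Matrix.mulVec_sum, Finset.smul_sum, Matrix.mulVec_smul, smul_smul,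
        Matrix.mulVec_mulVec, ← pow_succ']
    have e2 : ∑ k ∈ Finset.range (n + 1), w ^ (k + 1) • (N ^ k *ᵥ lastCol x) = p := by
      rw [Finset.sum_range_succ, pow_eq_zero_of_isNilpotent hN, Matrix.zero_mulVec, smul_zero,
        add_zero]
    rw [smul_add, e1, ← e2, Finset.sum_range_succ']
    simp
  let z : Fin (n + 1) → ℂ := Fin.snoc p 1
  have hz : x *ᵥ (w • z) = z := by
    funext a
    rw [Matrix.mulVec_smul]
    refine Fin.lastCases ?_ (fun a => ?_) a
    · simp only [Pi.smul_apply, Matrix.mulVec, dotProduct, Fin.sum_univ_castSucc, z, Fin.snoc_last,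
        Fin.snoc_castSucc]
      have e3 : w * ∑ i : Fin n, x (Fin.last n) i.castSucc * p i = ∑ k ∈ Finset.range n,
          w ^ (k + 2) * (lastRow x ⬝ᵥ (N ^ k *ᵥ lastCol x)) := by
        change w * (lastRow x ⬝ᵥ p) = _
        simp only [p, dotProduct_sum, dotProduct_smul, Finset.mul_sum, smul_eq_mul]
        refine Finset.sum_congr rfl fun k _ => ?_
        ring
      rw [smul_eq_mul, mul_add, e3]
      linear_combination -h0
    · have := congrFun hp a
      simp only [Pi.smul_apply, Matrix.mulVec, dotProduct, Fin.sum_univ_castSucc, z, Fin.snoc_last,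
        Fin.snoc_castSucc, mul_one]
      exact this
  have hz' : ∀ k, x ^ k *ᵥ (w ^ k • z) = z := by
    intro k
    induction k with
    | zero => simp
    | succ k ih =>
      rw [pow_succ, pow_succ, ← Matrix.mulVec_mulVec, mul_smul, Matrix.mulVec_smul, hz, ih]
  obtain ⟨k, hk⟩ := hx
  have h1 := congrFun (hz' k) (Fin.last n)
  rw [hk, Matrix.zero_mulVec] at h1
  simp [z] at h1

-- A complex polynomial in w without roots is constant, so all its higher coefficients vanish: these
-- are the corner entry and the products v N^k u.
open Polynomial in
theorem lastRow_dotProduct_eq_zero {n : ℕ} {x : Mat (n + 1)} (hx : IsNilpotent x)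
    (hN : IsNilpotent (proj n (Nat.le_succ n) x)) :
    x (Fin.last n) (Fin.last n) = 0 ∧
      ∀ k, lastRow x ⬝ᵥ (proj n (Nat.le_succ n) x ^ k *ᵥ lastCol x) = 0 := by
  have h0 := one_sub_mul_ne_zero_of_isNilpotent hx hN
  set d := x (Fin.last n) (Fin.last n)
  set c : ℕ → ℂ := fun k => lastRow x ⬝ᵥ (proj n (Nat.le_succ n) x ^ k *ᵥ lastCol x) with hc
  let Q : ℂ[X] := 1 - C d * X - ∑ k ∈ Finset.range n, C (c k) * X ^ (k + 2)
  have hQ : Q.degree = 0 := by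
    by_contra hne
    obtain ⟨w, hw⟩ := IsAlgClosed.exists_root Q hne
    apply h0 w
    rw [← hw]
    simp only [Q, eval_sub, eval_one, eval_mul, eval_C, eval_X, eval_finsetSum, eval_pow]
    congr 1
    · ring
    · exact Finset.sum_congr rfl fun k _ => mul_comm _ _
  have hcoeff : ∀ j, 0 < j → Q.coeff j = 0 := fun j hj =>
    coeff_eq_zero_of_degree_lt (by rw [hQ]; exact_mod_cast hj)
  constructor
  · have := hcoeff 1 one_pos
    simp only [Q, coeff_sub, coeff_C_mul, coeff_X_one, finsetSum_coeff, coeff_one, coeff_X_pow] at this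
    simpa using this
  · intro k
    by_cases hk : k < n
    · have := hcoeff (k + 2) (by omega)
      simp only [Q, coeff_sub, coeff_C_mul, finsetSum_coeff, coeff_one, coeff_X, coeff_X_pow] at this
      simpa [hk] using this
    · rw [pow_eq_zero_of_le (not_lt.1 hk) (pow_eq_zero_of_isNilpotent hN), Matrix.zero_mulVec,
        dotProduct_zero]

/-- Otherwise the embedded N^m annihilates x from both sides. It then commutes with x and is a
polynomial in x, against its independence from the powers of x. -/
theorem pow_mulVec_lastCol_ne_zero_or {m : ℕ} {x : Mat (m + 2)} (hx : x ∈ nilfiberSreg (m + 2)) :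
    proj (m + 1) (Nat.le_succ _) x ^ m *ᵥ lastCol x ≠ 0 ∨
      (proj (m + 1) (Nat.le_succ _) x)ᵀ ^ m *ᵥ lastRow x ≠ 0 := by
  by_contra! h
  obtain ⟨hu, hv⟩ := h
  set N := proj (m + 1) (Nat.le_succ _) x with hN
  have hN0 : N ^ (m + 1) = 0 := pow_eq_zero_of_isNilpotent
    (isNilpotent_of_mem_nilfiberSreg (proj_mem_nilfiberSreg hx))
  have hE : ∀ a b : Fin (m + 1), embed (m + 2) (N ^ m) a.castSucc b.castSucc = (N ^ m) a b := by
    intro a b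
    simp only [embed, Matrix.of_apply, Fin.val_castSucc]
    rw [dif_pos ⟨a.isLt, b.isLt⟩]
  have hE1 : ∀ a, embed (m + 2) (N ^ m) a (Fin.last _) = 0 := by
    intro a
    simp [embed]
  have hE2 : ∀ a, embed (m + 2) (N ^ m) (Fin.last _) a = 0 := by
    intro a
    simp [embed]
  have h1 : embed (m + 2) (N ^ m) * x = 0 := by
    ext a b
    rw [Matrix.mul_apply, Fin.sum_univ_castSucc, hE1, zero_mul, add_zero, Matrix.zero_apply]
    refine Fin.lastCases ?_ (fun a => ?_) a
    · simp [hE2]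
    · simp only [hE]
      refine Fin.lastCases ?_ (fun b => ?_) b
      · exact congrFun hu a
      · have : (N ^ m * N) a b = 0 := by rw [← pow_succ, hN0]; rfl
        exact this
  have h2 : x * embed (m + 2) (N ^ m) = 0 := by
    ext a b
    rw [Matrix.mul_apply, Fin.sum_univ_castSucc, hE2, mul_zero, add_zero, Matrix.zero_apply]
    refine Fin.lastCases ?_ (fun b => ?_) b
    · simp [hE1]
    · simp only [hE]
      refine Fin.lastCases ?_ (fun a => ?_) a
      · have := congrFun hv b
        rw [← Matrix.transpose_pow] at this
        simpa only [Matrix.mulVec, dotProduct, Matrix.transpose_apply, mul_comm] using! this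
      · have : (N * N ^ m) a b = 0 := by rw [← pow_succ', hN0]; rfl
        exact this
  obtain ⟨c, hc⟩ := exists_eq_sum_pow_of_commute (isNilpotent_of_mem_nilfiberSreg hx)
    (pow_ne_zero_of_mem_nilfiberSreg hx) (h2.trans h1.symm)
  have hli := (mem_nilfiberSreg_iff.1 hx).2
  rw [linearIndependent_iff_notMem_span] at hli
  refine hli ⟨(Fin.last (m + 1)).castSucc, Fin.last m⟩ ?_
  change embed (m + 2) (N ^ m) ∈ _
  rw [hc]
  refine Submodule.sum_mem _ fun j _ => Submodule.smul_mem _ _ (Submodule.subset_span ?_)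
  refine ⟨⟨Fin.last (m + 2), j⟩, ⟨trivial, ?_⟩, embed_self _⟩
  intro h
  have h3 := congrArg (fun p : (Σ i : Fin (m + 3), Fin i.val) => p.1.val) h
  simp at h3

theorem towerBorel_congr {S S' : ℕ → Bool} {n : ℕ} (h : ∀ b < n, S b = S' b) :
    towerBorel S n = towerBorel S' n := by
  have : signOrder S n = signOrder S' n := by
    funext b
    rw [signOrder, signOrder, h b.val b.isLt]
  rw [towerBorel, towerBorel, this]

theorem mem_towerBorel_succ {S : ℕ → Bool} {n : ℕ} {x : Mat (n + 1)}
    (hx : proj n (Nat.le_succ n) x ∈ towerBorel S n) (h1 : S n = true → lastRow x = 0)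
    (h2 : S n = false → lastCol x = 0) : x ∈ towerBorel S (n + 1) := by
  intro a b hab
  induction a using Fin.lastCases with
  | last =>
    induction b using Fin.lastCases with
    | last => exact absurd hab (lt_irrefl _)
    | cast b =>
      cases hS : S n with
      | true => exact congrFun (h1 hS) b
      | false => exact absurd hab (lt_asymm (signOrder_gt_of_lt hS (Fin.castSucc_lt_last b)))
  | cast a =>
    induction b using Fin.lastCases with
    | last =>
      cases hS : S n with
      | true => exact absurd hab (lt_asymm (signOrder_lt_of_lt hS (Fin.castSucc_lt_last a)))
      | false => exact congrFun (h2 hS) a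
    | cast b => exact hx a b hab

theorem eq_zero_of_dotProduct_eq_zero {m : ℕ} {N : Mat (m + 1)} {u v : Fin (m + 1) → ℂ}
    (hN : IsNilpotent N) (hu : N ^ m *ᵥ u ≠ 0) (h : ∀ k, v ⬝ᵥ (N ^ k *ᵥ u) = 0) : v = 0 := by
  refine dotProduct_eq_zero v fun w => ?_
  obtain ⟨c, rfl⟩ := exists_eq_sum_pow_mulVec
    (by rw [pow_eq_zero_of_isNilpotent hN, Matrix.zero_mulVec]) hu w
  rw [dotProduct_sum]
  exact Finset.sum_eq_zero fun k _ => by rw [dotProduct_smul, h, smul_zero]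

/-- The new sign records whether the last column or the last row is cyclic for the corner. A cyclic
column is paired to zero with the row on all its N-translates, which span, so the row vanishes; the
other case is its transpose. -/
theorem exists_mem_towerBorel {n : ℕ} {x : Mat n} (hx : x ∈ nilfiberSreg n) :
    ∃ S, x ∈ towerBorel S n := by
  induction n with
  | zero => exact ⟨fun _ => true, fun a => a.elim0⟩
  | succ n ih =>
    obtain ⟨S, hS⟩ := ih (proj_mem_nilfiberSreg hx)
    rcases n with _ | m
    · exact ⟨S, by rw [towerBorel_one]; trivial⟩
    have hN := isNilpotent_of_mem_nilfiberSreg (proj_mem_nilfiberSreg hx)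
    have hdot := (lastRow_dotProduct_eq_zero (isNilpotent_of_mem_nilfiberSreg hx) hN).2
    have hS' : ∀ s, proj (m + 1) (Nat.le_succ _) x ∈
        towerBorel (Function.update S (m + 1) s) (m + 1) := by
      intro s
      rwa [towerBorel_congr (S' := S)]
      intro b hb
      rw [Function.update_of_ne hb.ne]
    rcases pow_mulVec_lastCol_ne_zero_or hx with h | h
    · refine ⟨Function.update S (m + 1) true, mem_towerBorel_succ (hS' _) ?_ ?_⟩
      · exact fun _ => eq_zero_of_dotProduct_eq_zero hN h hdot
      · intro h; simp at h
    · refine ⟨Function.update S (m + 1) false, mem_towerBorel_succ (hS' _) ?_ ?_⟩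
      · intro h; simp at h
      · refine fun _ => eq_zero_of_dotProduct_eq_zero
          ((Matrix.isNilpotent_transpose_iff).2 hN) h fun k => ?_
        rw [← hdot k, ← Matrix.transpose_pow, Matrix.mulVec_transpose, dotProduct_comm,
          Matrix.dotProduct_mulVec]

/-! ### Regular triangular matrices are strongly regular -/

theorem proj_mem_regTriangular {S : ℕ → Bool} {n i : ℕ} (hi : i ≤ n) {x : Mat n}
    (hx : x ∈ regTriangular (signOrder S n)) :
    proj i hi x ∈ regTriangular (signOrder S i) := by
  refine ⟨fun a b h => hx.1 _ _ h, fun a b h => hx.2 _ _ ⟨h.1, fun c hc => ?_⟩⟩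
  -- An index outside the corner comes before or after all indices of the corner, so consecutive
  -- pairs of the corner remain consecutive.
  by_cases hci : c.val < i
  · exact h.2 ⟨c.val, hci⟩ hc
  · have ha := a.isLt
    have hb := b.isLt
    cases hS : S c.val with
    | true => exact (signOrder_lt_of_lt hS (Fin.lt_def.2 (by simp; omega))).le
    | false =>
      exact absurd hc (lt_asymm (signOrder_gt_of_lt hS (Fin.lt_def.2 (by simp; omega))))

/-- Transposition reverses the order, which amounts to negating all signs; it reduces negative last
signs to positive ones. -/
theorem transpose_mem_regTriangular {S : ℕ → Bool} {n : ℕ} {x : Mat n}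
    (hx : x ∈ regTriangular (signOrder S n)) :
    xᵀ ∈ regTriangular (signOrder (fun b => !S b) n) := by
  have hs : ∀ a, signOrder (fun b => !S b) n a = -signOrder S n a := congrFun (signOrder_not S n)
  refine ⟨fun a b h => hx.1 b a ?_, fun a b h => hx.2 b a ?_⟩
  · rw [hs, hs] at h
    omega
  · obtain ⟨h1, h2⟩ := h
    simp only [hs] at h1 h2
    refine ⟨by omega, fun c hc => ?_⟩
    by_contra! hlt
    have := h2 c (by omega)
    omega

theorem pow_mulVec_last_ne_zero {S : ℕ → Bool} {m : ℕ} {x : Mat (m + 1)} (hS : S m = true)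
    (hx : x ∈ regTriangular (signOrder S (m + 1))) :
    x ^ m *ᵥ Pi.single (Fin.last m) 1 ≠ 0 :=
  pow_mulVec_single_ne_zero (signOrder_injective S _) hx (signOrder_le_last hS)

theorem embed_apply_last {n i : ℕ} (hi : i ≤ n) (y : Mat i) (a : Fin (n + 1)) :
    embed (n + 1) y a (Fin.last n) = 0 ∧ embed (n + 1) y (Fin.last n) a = 0 := by
  constructor <;> simp only [embed, Matrix.of_apply] <;> rw [dif_neg] <;>
    simp only [Fin.val_last] <;> omega

/-- If the last sign is positive, f reads the last column: smaller corners have none, and the last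
basis vector is cyclic for x. If it is negative, f reads the last row. -/
theorem exists_linearMap_of_regTriangular {S : ℕ → Bool} {m : ℕ} {x : Mat (m + 1)}
    (hx : x ∈ regTriangular (signOrder S (m + 1))) :
    ∃ f : Mat (m + 1) →ₗ[ℂ] (Fin (m + 1) → ℂ),
      (∀ i ≤ m, ∀ y : Mat i, f (embed (m + 1) y) = 0) ∧
      LinearIndependent ℂ fun j : Fin (m + 1) => f (x ^ j.val) := by
  cases hS : S m with
  | true =>
    refine ⟨(Matrix.mulVecBilin ℂ ℂ).flip (Pi.single (Fin.last m) 1), fun i hi y => ?_, ?_⟩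
    · funext a
      change (embed (m + 1) y *ᵥ Pi.single (Fin.last m) 1) a = 0
      simp [(embed_apply_last hi y a).1]
    · refine linearIndependent_pow_mulVec ?_ (pow_mulVec_last_ne_zero hS hx)
      rw [pow_eq_zero_of_isNilpotent (isNilpotent_of_strict hx.1), Matrix.zero_mulVec]
  | false =>
    have hx' := transpose_mem_regTriangular hx
    refine ⟨(Matrix.mulVecBilin ℂ ℂ).flip (Pi.single (Fin.last m) 1) ∘ₗ
      (Matrix.transposeLinearEquiv (Fin (m + 1)) (Fin (m + 1)) ℂ ℂ).toLinearMap,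
      fun i hi y => ?_, ?_⟩
    · funext a
      change ((embed (m + 1) y)ᵀ *ᵥ Pi.single (Fin.last m) 1) a = 0
      simp [(embed_apply_last hi y a).2]
    · have h := linearIndependent_pow_mulVec ?_
        (pow_mulVec_last_ne_zero (by simp [hS]) hx')
      · convert h using 2 with j
        rw [← Matrix.transpose_pow]
        rfl
      · rw [pow_eq_zero_of_isNilpotent (isNilpotent_of_strict hx'.1), Matrix.zero_mulVec]

/-- The map f kills all smaller corners and thus the coefficients of the powers of x vanish first;
what is left of the relation projects to the corner, where induction applies. -/
theorem linearIndependent_of_regTriangular {S : ℕ → Bool} {n : ℕ} {x : Mat n}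
    (hx : x ∈ regTriangular (signOrder S n)) :
    LinearIndependent ℂ fun p : (Σ i : Fin (n + 1), Fin i.val) =>
      embed n (proj p.1.val (Nat.le_of_lt_succ p.1.isLt) x ^ p.2.val) := by
  induction n with
  | zero =>
    have : IsEmpty (Σ i : Fin (0 + 1), Fin i.val) :=
      ⟨fun p => (Fin.cast (by have := p.1.isLt; omega) p.2 : Fin 0).elim0⟩
    exact linearIndependent_empty_type
  | succ n ih =>
    have ih := Fintype.linearIndependent_iff.1 (ih (proj_mem_regTriangular (Nat.le_succ n) hx))
    rw [Fintype.linearIndependent_iff]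
    intro g hg
    rw [Fintype.sum_sigma, Fin.sum_univ_castSucc] at hg
    obtain ⟨f, hf, hli⟩ := exists_linearMap_of_regTriangular hx
    have hlast : ∀ j : Fin (n + 1), g ⟨Fin.last (n + 1), j⟩ = 0 := by
      refine Fintype.linearIndependent_iff.1 hli (fun j => g ⟨Fin.last (n + 1), j⟩) ?_
      have h := congrArg f hg
      rw [map_add, map_sum, map_zero, Finset.sum_eq_zero, zero_add, map_sum] at h
      · rw [← h]
        refine Finset.sum_congr rfl fun j _ => ?_
        rw [map_smul]
        congr 2
        exact (embed_self _).symm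
      · intro i _
        rw [map_sum]
        refine Finset.sum_eq_zero fun j _ => ?_
        rw [map_smul, hf _ (Nat.le_of_lt_succ i.isLt), smul_zero]
    have hrest : ∀ p : (Σ i : Fin (n + 1), Fin i.val), g ⟨p.1.castSucc, p.2⟩ = 0 := by
      refine ih (fun p => g ⟨p.1.castSucc, p.2⟩) ?_
      have h := congrArg (proj n (Nat.le_succ n)) hg
      rw [map_add, map_zero, map_sum] at h
      have h2 : (∑ j : Fin (Fin.last (n + 1)).val, g ⟨Fin.last (n + 1), j⟩ •
          embed (n + 1) (proj (Fin.last (n + 1)).val (Nat.le_of_lt_succ (Fin.last (n + 1)).isLt) x ^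
            j.val)) = 0 :=
        Finset.sum_eq_zero fun j _ => by rw [hlast j, zero_smul]
      rw [h2, map_zero, add_zero] at h
      rw [Fintype.sum_sigma, ← h]
      refine Finset.sum_congr rfl fun i _ => ?_
      rw [map_sum]
      rfl
    rintro ⟨i, j⟩
    induction i using Fin.lastCases with
    | last => exact hlast j
    | cast i => exact hrest ⟨i, j⟩

theorem regNilpotents_towerBorel (S : ℕ → Bool) (n : ℕ) :
    regNilpotents (towerBorel S n) = regTriangular (signOrder S n) :=
  regNilpotents_triangular (signOrder_injective S n)

theorem regTriangular_subset_nilfiberSreg (S : ℕ → Bool) (n : ℕ) :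
    regTriangular (signOrder S n) ⊆ nilfiberSreg n := fun _ hx =>
  mem_nilfiberSreg_iff.2 ⟨fun _ hi => isNilpotent_of_strict (proj_mem_regTriangular hi hx).1,
    linearIndependent_of_regTriangular hx⟩

theorem exists_mem_regTriangular {n : ℕ} {x : Mat n} (hx : x ∈ nilfiberSreg n) :
    ∃ S, x ∈ regTriangular (signOrder S n) := by
  obtain ⟨S, hS⟩ := exists_mem_towerBorel hx
  refine ⟨S, ?_⟩
  rw [← regNilpotents_towerBorel]
  refine ⟨hS, isNilpotent_of_mem_nilfiberSreg hx, ?_⟩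
  rcases n with _ | m
  · exact Module.finrank_zero_of_subsingleton
  · exact isRegularElt_of_pow_ne_zero (isNilpotent_of_mem_nilfiberSreg hx)
      (pow_ne_zero_of_mem_nilfiberSreg hx)

/-! ### The pieces of the strongly regular nilfiber -/

/-- The predecessor of b among the smaller indices is its predecessor overall, because a larger
index precedes or follows all of them. -/
theorem apply_ne_zero_of_sign_true {S : ℕ → Bool} {n : ℕ} {x : Mat n}
    (hx : x ∈ regTriangular (signOrder S n)) {b : Fin n} (hb : 0 < b.val) (hS : S b.val = true) :
    ∃ a < b, x a b ≠ 0 := by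
  have hne : (Finset.univ.filter fun a : Fin n => a < b).Nonempty :=
    ⟨⟨0, hb.trans b.isLt⟩, Finset.mem_filter.2 ⟨Finset.mem_univ _, Fin.lt_def.2 hb⟩⟩
  obtain ⟨a, ha, hmax⟩ := Finset.exists_max_image _ (signOrder S n) hne
  simp only [Finset.mem_filter, Finset.mem_univ, true_and] at ha hmax
  refine ⟨a, ha, hx.2 a b ⟨signOrder_lt_of_lt hS ha, fun c hc => ?_⟩⟩
  rcases lt_trichotomy c b with h | rfl | h
  · exact absurd (hmax c h) (not_le.2 hc)
  · exact le_rfl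
  · cases hc' : S c.val with
    | true => exact (signOrder_lt_of_lt hc' h).le
    | false => exact absurd hc (lt_asymm (signOrder_gt_of_lt hc' (ha.trans h)))

theorem apply_ne_zero_of_sign_false {S : ℕ → Bool} {n : ℕ} {x : Mat n}
    (hx : x ∈ regTriangular (signOrder S n)) {b : Fin n} (hb : 0 < b.val) (hS : S b.val = false) :
    ∃ a < b, x b a ≠ 0 :=
  apply_ne_zero_of_sign_true (transpose_mem_regTriangular hx) hb (by simp [hS])

/-- Membership in the second Borel subalgebra suffices, without regularity. Hence the pieces are not
only disjoint but relatively closed in the nilfiber. -/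
theorem sign_eq_of_mem_regTriangular {S S' : ℕ → Bool} {n : ℕ} {x : Mat n}
    (hx : x ∈ regTriangular (signOrder S n))
    (hx' : x ∈ towerBorel S' n) {b : ℕ} (hb : 0 < b) (hbn : b < n) : S b = S' b := by
  cases hS : S b with
  | true =>
    obtain ⟨a, ha, hne⟩ := apply_ne_zero_of_sign_true hx (b := ⟨b, hbn⟩) hb hS
    by_contra h
    exact hne (hx' _ _ (signOrder_gt_of_lt (by simpa using Ne.symm h) ha))
  | false =>
    obtain ⟨a, ha, hne⟩ := apply_ne_zero_of_sign_false hx (b := ⟨b, hbn⟩) hb hS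
    by_contra h
    exact hne (hx' _ _ (signOrder_lt_of_lt (by simpa using Ne.symm h) ha))

theorem regTriangular_nonempty {n : ℕ} (ρ : Fin n → ℤ) : (regTriangular ρ).Nonempty :=
  ⟨Matrix.of fun a b => if ρ a < ρ b then 1 else 0,
    fun a b h => if_neg (not_lt.2 h), fun a b h => by simp [h.1]⟩

theorem mem_towerBorel_of_mem_regTriangular {S : ℕ → Bool} {n : ℕ} {x : Mat n}
    (hx : x ∈ regTriangular (signOrder S n)) : x ∈ towerBorel S n := fun a b h => hx.1 a b h.le

/-! ### Irreducibility -/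

theorem isClosed_zeroSet {n : ℕ} (F : Set (MvPolynomial (Fin n × Fin n) ℂ)) :
    @IsClosed _ (zariski n) (zeroSet F) := by
  let _ := zariski n
  refine isOpen_compl_iff.1 ?_
  change (zeroSet F)ᶜᶜ ∈ Set.range zeroSet
  rw [compl_compl]
  exact ⟨F, rfl⟩

theorem isClosed_triangular {n : ℕ} (ρ : Fin n → ℤ) :
    @IsClosed _ (zariski n) (triangular ρ : Set (Mat n)) := by
  convert isClosed_zeroSet {p | ∃ a b, ρ b < ρ a ∧ p = MvPolynomial.X (a, b)}
  ext x
  constructor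
  · rintro hx _ ⟨a, b, hab, rfl⟩
    rw [MvPolynomial.eval_X]
    exact hx a b hab
  · intro hx a b hab
    have := hx _ ⟨a, b, hab, rfl⟩
    rwa [MvPolynomial.eval_X] at this

theorem exists_eval_ne_zero_of_isOpen {n : ℕ} {U : Set (Mat n)} (hU : @IsOpen _ (zariski n) U)
    {x : Mat n} (hx : x ∈ U) : ∃ p : MvPolynomial (Fin n × Fin n) ℂ,
      MvPolynomial.eval (fun ab => x ab.1 ab.2) p ≠ 0 ∧
      ∀ y : Mat n, MvPolynomial.eval (fun ab => y ab.1 ab.2) p ≠ 0 → y ∈ U := by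
  obtain ⟨F, hF⟩ : Uᶜ ∈ Set.range zeroSet := hU
  have hx' : x ∉ zeroSet F := by rw [hF]; exact fun h => h hx
  simp only [zeroSet, Set.mem_ofPred_eq] at hx'
  push Not at hx'
  obtain ⟨p, hp, hne⟩ := hx'
  refine ⟨p, hne, fun y hy => ?_⟩
  by_contra hyU
  have : y ∈ zeroSet F := by rw [hF]; exact hyU
  exact hy (this p hp)

-- On the line joining a point of each open set, being in either open set and being regular are
-- implied by the nonvanishing of one-variable polynomials. None of these is zero, so their product
-- is nonzero at some parameter.
open Polynomial in
theorem isIrreducible_regTriangular {n : ℕ} (ρ : Fin n → ℤ) :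
    @IsIrreducible _ (zariski n) (regTriangular ρ) := by
  classical
  let _ := zariski n
  refine ⟨regTriangular_nonempty ρ, ?_⟩
  rintro U V hU hV ⟨x, hx, hxU⟩ ⟨y, hy, hyV⟩
  obtain ⟨p, hp, hpU⟩ := exists_eval_ne_zero_of_isOpen hU hxU
  obtain ⟨q, hq, hqV⟩ := exists_eval_ne_zero_of_isOpen hV hyV
  let l : Fin n × Fin n → ℂ[X] := fun ab => C (x ab.1 ab.2) + X * C (y ab.1 ab.2 - x ab.1 ab.2)
  let z : ℂ → Mat n := fun t => x + t • (y - x)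
  have hl : ∀ t ab, (l ab).eval t = z t ab.1 ab.2 := fun t ab => by
    simp [l, z]
  have hev : ∀ t (f : MvPolynomial (Fin n × Fin n) ℂ),
      (MvPolynomial.aeval l f).eval t = MvPolynomial.eval (fun ab => z t ab.1 ab.2) f := by
    intro t f
    induction f using MvPolynomial.induction_on with
    | C a => simp
    | add f g hf hg => simp [hf, hg]
    | mul_X f i hf => simp [hf, hl]
  have hz0 : z 0 = x := by simp [z]
  have hz1 : z 1 = y := by simp [z]
  -- R is the product of the entries at consecutive indices along the line; where it does not
  -- vanish, the point of the line is regular.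
  let R : ℂ[X] := ∏ ab ∈ Finset.univ.filter fun ab : Fin n × Fin n => IsSuccessor ρ ab.1 ab.2, l ab
  have hR : R ≠ 0 := by
    refine Finset.prod_ne_zero_iff.2 fun ab hab h => ?_
    have h1 := hl 0 ab
    rw [h, hz0, eval_zero] at h1
    exact hx.2 _ _ (Finset.mem_filter.1 hab).2 h1.symm
  have hP : MvPolynomial.aeval l p ≠ 0 := by
    intro h
    have h1 := hev 0 p
    rw [h, hz0, eval_zero] at h1
    exact hp h1.symm
  have hQ : MvPolynomial.aeval l q ≠ 0 := by
    intro h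
    have h1 := hev 1 q
    rw [h, hz1, eval_zero] at h1
    exact hq h1.symm
  obtain ⟨t, ht⟩ : ∃ t, (MvPolynomial.aeval l p * MvPolynomial.aeval l q * R).eval t ≠ 0 := by
    by_contra! h
    exact mul_ne_zero (mul_ne_zero hP hQ) hR (Polynomial.funext fun t => by rw [h t, eval_zero])
  rw [eval_mul, eval_mul, hev, hev] at ht
  refine ⟨z t, ⟨fun a b hab => ?_, fun a b hab => ?_⟩, hpU _ (left_ne_zero_of_mul
    (left_ne_zero_of_mul ht)), hqV _ (right_ne_zero_of_mul (left_ne_zero_of_mul ht))⟩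
  · simp [z, hx.1 a b hab, hy.1 a b hab]
  · have h1 := right_ne_zero_of_mul ht
    simp only [R, eval_prod] at h1
    have h2 := Finset.prod_ne_zero_iff.1 h1 (a, b) (by simpa using hab)
    rwa [hl] at h2

/-- An irreducible subset of a finite union of relatively closed pieces lies in a single piece, and
disjointness makes every piece maximal. -/
theorem image_irreducibleComponents {X ι : Type*} [TopologicalSpace X] [Finite ι] {S : Set X}
    {C Z : ι → Set X} (hS : S = ⋃ i, C i) (hC : ∀ i, IsIrreducible (C i))
    (hdisj : Pairwise fun i j => Disjoint (C i) (C j)) (hZ : ∀ i, IsClosed (Z i))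
    (hSZ : ∀ i, S ∩ Z i = C i) :
    (fun D : Set S => Subtype.val '' D) '' irreducibleComponents S = Set.range C := by
  have hsub : ∀ i, C i ⊆ S := fun i => by rw [← hSZ]; exact Set.inter_subset_left
  let C' : ι → Set S := fun i => Subtype.val ⁻¹' C i
  have himg : ∀ i, Subtype.val '' C' i = C i := fun i => by
    rw [Subtype.image_preimage_coe, Set.inter_eq_right.2 (hsub i)]
  have hclosed : ∀ i, IsClosed (C' i) := by
    intro i
    have : C' i = Subtype.val ⁻¹' Z i := by
      ext x
      change x.val ∈ C i ↔ x.val ∈ Z i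
      rw [← hSZ]
      exact ⟨fun h => h.2, fun h => ⟨x.2, h⟩⟩
    rw [this]
    exact (hZ i).preimage continuous_subtype_val
  have hirr : ∀ i, IsIrreducible (C' i) := by
    intro i
    obtain ⟨x, hx⟩ := (hC i).1
    refine ⟨⟨⟨x, hsub i hx⟩, hx⟩, ?_⟩
    rintro U V hU hV ⟨u, huC, huU⟩ ⟨v, hvC, hvV⟩
    obtain ⟨U', hU', rfl⟩ := isOpen_induced_iff.1 hU
    obtain ⟨V', hV', rfl⟩ := isOpen_induced_iff.1 hV
    obtain ⟨w, hwC, hwU, hwV⟩ := (hC i).2 U' V' hU' hV' ⟨u, huC, huU⟩ ⟨v, hvC, hvV⟩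
    exact ⟨⟨w, hsub i hwC⟩, hwC, hwU, hwV⟩
  have hle : ∀ D : Set S, IsIrreducible D → ∃ i, D ⊆ C' i := by
    intro D hD
    have := Fintype.ofFinite ι
    classical
    obtain ⟨t, ht, hDt⟩ := isIrreducible_iff_sUnion_isClosed.1 hD (Finset.univ.image C')
      (by simpa using hclosed) (fun x _ => by
        obtain ⟨i, hi⟩ := Set.mem_iUnion.1 (hS ▸ x.2 : x.val ∈ ⋃ i, C i)
        exact ⟨C' i, by simp, hi⟩)
    obtain ⟨i, -, rfl⟩ := Finset.mem_image.1 ht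
    exact ⟨i, hDt⟩
  have hmax : ∀ i, C' i ∈ irreducibleComponents S := by
    intro i
    refine ⟨hirr i, fun D hD hCD => ?_⟩
    obtain ⟨j, hj⟩ := hle D hD
    have hij : i = j := by
      by_contra hne
      obtain ⟨x, hx⟩ := (hirr i).1
      exact Set.disjoint_left.1 (hdisj hne) hx (hj (hCD hx))
    rw [hij]
    exact hj
  ext D
  constructor
  · rintro ⟨D, hD, rfl⟩
    obtain ⟨i, hi⟩ := hle D hD.1
    refine ⟨i, ?_⟩
    rw [← himg i]
    exact congrArg (Subtype.val '' ·) (le_antisymm (hD.2 (hirr i) hi) hi)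
  · rintro ⟨i, rfl⟩
    exact ⟨C' i, hmax i, himg i⟩

/-! ### Orbits of the group `A` -/

theorem pairwise_commute_gzFlowHom (n : ℕ) : Pairwise fun p q : (Σ i : Fin n, Fin i.val) =>
    ∀ s t, Commute (gzFlowHom (n := n) p.1.val p.1.isLt.le p.2.val s)
      (gzFlowHom q.1.val q.1.isLt.le q.2.val t) :=
  fun _ _ _ _ _ => Equiv.ext fun _ => gzFlow_comm _ _ _ _ _ _ _

theorem actionA_eq (n : ℕ) : actionA n =
    MonoidHom.noncommPiCoprod _ (pairwise_commute_gzFlowHom n) := rfl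

theorem actionA_mulSingle {n : ℕ} (p : Σ i : Fin n, Fin i.val) (t : ℂ) (x : Mat n) :
    actionA n (Pi.mulSingle p (Multiplicative.ofAdd t)) x =
      gzFlow p.1.val p.1.isLt.le p.2.val t x := by
  rw [actionA_eq, MonoidHom.noncommPiCoprod_mulSingle]
  rfl

theorem mem_orbitA_self {n : ℕ} (x : Mat n) : x ∈ orbitA x := ⟨1, by rw [map_one]; rfl⟩

theorem mem_orbitA_trans {n : ℕ} {x y z : Mat n} (hxy : y ∈ orbitA x) (hyz : z ∈ orbitA y) :
    z ∈ orbitA x := by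
  obtain ⟨a, rfl⟩ := hxy
  obtain ⟨b, rfl⟩ := hyz
  exact ⟨b * a, by rw [map_mul]; rfl⟩

theorem gzFlow_mem_orbitA {n i : ℕ} (hi : i < n) {j : ℕ} (hj : j < i) (t : ℂ) (x : Mat n) :
    gzFlow i hi.le j t x ∈ orbitA x :=
  ⟨_, (actionA_mulSingle ⟨⟨i, hi⟩, ⟨j, hj⟩⟩ t x).symm⟩

/-- The image of A is generated by the one-parameter flows, so a property preserved by each flow is
preserved along the orbit. -/
theorem orbitA_induction {n : ℕ} {x y : Mat n} (hy : y ∈ orbitA x) (P : Mat n → Prop) (hx : P x)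
    (h : ∀ i (hi : i < n) j, j < i → ∀ t z, P z → P (gzFlow i hi.le j t z)) : P y := by
  obtain ⟨a, rfl⟩ := hy
  -- Only forward preservation of P is assumed, hence a submonoid rather than a subgroup.
  let M : Submonoid (Equiv.Perm (Mat n)) :=
    { carrier := {e | ∀ z, P z → P (e z)}
      one_mem' := fun _ hz => hz
      mul_mem' := fun he hf z hz => he _ (hf z hz) }
  have h1 : actionA n a ∈ MonoidHom.mrange (actionA n) := ⟨a, rfl⟩
  rw [actionA_eq, MonoidHom.noncommPiCoprod_mrange] at h1
  have h2 : (⨆ p : (Σ i : Fin n, Fin i.val), MonoidHom.mrange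
      (gzFlowHom (n := n) p.1.val p.1.isLt.le p.2.val)) ≤ M := by
    refine iSup_le fun p => ?_
    rintro _ ⟨t, rfl⟩ z hz
    exact h p.1.val p.1.isLt p.2.val p.2.isLt t.toAdd z hz
  exact h2 h1 x hx

theorem conj_pow_of_isUnit {n : ℕ} {g : Mat n} (hg : IsUnit g) (x : Mat n) (k : ℕ) :
    (g * x * g⁻¹) ^ k = g * x ^ k * g⁻¹ := by
  obtain ⟨u, rfl⟩ := hg
  rw [← Matrix.coe_units_inv, Units.conj_pow]

theorem conj_ne_zero_of_isUnit {n : ℕ} {g x : Mat n} (hg : IsUnit g) (hx : x ≠ 0) :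
    g * x * g⁻¹ ≠ 0 := by
  obtain ⟨u, rfl⟩ := hg
  rw [← Matrix.coe_units_inv]
  rwa [Ne, Units.mul_left_eq_zero, Units.mul_right_eq_zero]

theorem pow_ne_zero_of_mem_regTriangular {S : ℕ → Bool} {m : ℕ} {x : Mat (m + 1)}
    (hx : x ∈ regTriangular (signOrder S (m + 1))) : x ^ m ≠ 0 :=
  pow_ne_zero_of_mem_nilfiberSreg (regTriangular_subset_nilfiberSreg S _ hx)

/-- The gradient is built from x and the diagonal corner projector, so it lies in the Borel
subalgebra, and conjugation by its exponential preserves that subalgebra. Regularity persists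
because conjugation keeps the top power nonzero. -/
theorem gzFlow_mem_regTriangular {S : ℕ → Bool} {n i : ℕ} (hi : i ≤ n) (j : ℕ) (t : ℂ) {x : Mat n}
    (hx : x ∈ regTriangular (signOrder S n)) :
    gzFlow i hi j t x ∈ regTriangular (signOrder S n) := by
  rcases n with _ | m
  · rwa [Subsingleton.elim (gzFlow i hi j t x) x]
  have hg : IsUnit (NormedSpace.exp (t • gzGrad i hi j x)) := Matrix.isUnit_exp _
  have hn := isNilpotent_of_strict hx.1
  have hxb : Matrix.BlockTriangular x (signOrder S (m + 1)) := mem_towerBorel_of_mem_regTriangular hx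
  have hP : Matrix.BlockTriangular (cornerOne (m + 1) i) (signOrder S (m + 1)) :=
    Matrix.blockTriangular_diagonal _
  have hG : Matrix.BlockTriangular (t • gzGrad i hi j x) (signOrder S (m + 1)) := by
    intro a b hab
    rw [gzGrad_eq, Matrix.smul_apply, Matrix.smul_apply,
      hP.mul (((hP.mul hxb).mul hP).pow j) hab, smul_zero, smul_zero]
  rw [← regNilpotents_towerBorel]
  refine ⟨?_, ?_, ?_⟩
  · have h : Matrix.BlockTriangular (gzFlow i hi j t x) (signOrder S (m + 1)) := by
      rw [gzFlow, ← Matrix.exp_neg]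
      exact (hG.exp.mul hxb).mul hG.neg.exp
    exact fun a b hab => h hab
  · obtain ⟨k, hk⟩ := hn
    exact ⟨k, by rw [gzFlow, conj_pow_of_isUnit hg, hk, mul_zero, zero_mul]⟩
  · refine isRegularElt_of_pow_ne_zero ?_ ?_
    · obtain ⟨k, hk⟩ := hn
      exact ⟨k, by rw [gzFlow, conj_pow_of_isUnit hg, hk, mul_zero, zero_mul]⟩
    · rw [gzFlow, conj_pow_of_isUnit hg]
      exact conj_ne_zero_of_isUnit hg (pow_ne_zero_of_mem_regTriangular hx)

theorem orbitA_subset_regTriangular {S : ℕ → Bool} {n : ℕ} {x : Mat n}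
    (hx : x ∈ regTriangular (signOrder S n)) : orbitA x ⊆ regTriangular (signOrder S n) :=
  fun _ hy => orbitA_induction hy _ hx fun _ hi j _ t _ hz => gzFlow_mem_regTriangular hi.le j t hz

theorem gzGrad_transpose {n i : ℕ} (hi : i ≤ n) (j : ℕ) (x : Mat n) :
    gzGrad i hi j xᵀ = (gzGrad i hi j x)ᵀ := by
  have h1 : proj i hi xᵀ = (proj i hi x)ᵀ := rfl
  rw [gzGrad, gzGrad, h1, ← Matrix.transpose_pow, Matrix.transpose_smul]
  congr 1
  ext a b
  simp only [embed, Matrix.of_apply, Matrix.transpose_apply, and_comm]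

/-- Transposing a conjugation inverts the conjugating matrix, which reverses time. -/
theorem gzFlow_transpose {n i : ℕ} (hi : i ≤ n) (j : ℕ) (t : ℂ) (x : Mat n) :
    gzFlow i hi j t xᵀ = (gzFlow i hi j (-t) x)ᵀ := by
  rw [gzFlow, gzFlow, gzGrad_transpose, ← Matrix.exp_neg, ← Matrix.exp_neg, Matrix.transpose_mul,
    Matrix.transpose_mul, ← Matrix.exp_transpose, ← Matrix.exp_transpose, neg_smul, neg_neg,
    Matrix.transpose_neg, Matrix.transpose_smul, mul_assoc]

theorem transpose_mem_orbitA {n : ℕ} {x y : Mat n} (hy : y ∈ orbitA x) : yᵀ ∈ orbitA xᵀ := by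
  refine orbitA_induction hy (fun z => zᵀ ∈ orbitA xᵀ) (mem_orbitA_self _) ?_
  intro i hi j hj t z hz
  refine mem_orbitA_trans hz ?_
  have h := gzFlow_transpose hi.le j (-t) z
  rw [neg_neg] at h
  rw [← h]
  exact gzFlow_mem_orbitA hi hj _ _

/-! ### The flows on the corners and on the last column -/

/-- The embedding `gl(i) → gl(n)` as a linear map. -/
def embedLinear (n i : ℕ) : Mat i →ₗ[ℂ] Mat n where
  toFun := embed n
  map_add' x y := by
    ext a b
    simp only [embed, Matrix.of_apply, Matrix.add_apply]
    split_ifs <;> simp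
  map_smul' c x := by
    ext a b
    simp only [embed, Matrix.of_apply, Matrix.smul_apply, RingHom.id_apply]
    split_ifs <;> simp

/-- The embedding sends 1 to the corner projector rather than to 1, so the two exponentials agree
only after multiplication by an embedded matrix. -/
theorem exp_embed_mul {n i : ℕ} (hi : i ≤ n) (y z : Mat i) :
    NormedSpace.exp (embed n y) * embed n z = embed n (NormedSpace.exp y * z) := by
  refine map_exp_eq (embed n y) y (LinearMap.mulRight ℂ (embed n z))
    (embedLinear n i ∘ₗ LinearMap.mulRight ℂ z) fun j => ?_
  change embed n y ^ j * embed n z = embed n (y ^ j * z)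
  induction j with
  | zero => simp
  | succ j ih => rw [pow_succ', pow_succ', mul_assoc, ih, mul_assoc, embed_mul hi y]

theorem embed_mul_exp {n i : ℕ} (hi : i ≤ n) (y z : Mat i) :
    embed n z * NormedSpace.exp (embed n y) = embed n (z * NormedSpace.exp y) := by
  refine map_exp_eq (embed n y) y (LinearMap.mulLeft ℂ (embed n z))
    (embedLinear n i ∘ₗ LinearMap.mulLeft ℂ z) fun j => ?_
  change embed n z * embed n y ^ j = embed n (z * y ^ j)
  induction j with
  | zero => simp
  | succ j ih => rw [pow_succ, pow_succ, ← mul_assoc, ih, ← mul_assoc, embed_mul hi _ y]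

theorem embed_embed {n i k : ℕ} (hik : i ≤ k) (y : Mat i) :
    embed n (embed k y) = embed n y := by
  ext a b
  simp only [embed, Matrix.of_apply]
  by_cases h : a.val < i ∧ b.val < i
  · rw [dif_pos h, dif_pos ⟨h.1.trans_le hik, h.2.trans_le hik⟩, dif_pos h]
  · rw [dif_neg h]
    split_ifs <;> rfl

theorem smul_gzGrad_eq_embed {n i k : ℕ} (hik : i ≤ k) (hk : k ≤ n) (j : ℕ) (t : ℂ) (x : Mat n) :
    t • gzGrad i (hik.trans hk) j x = embed n (t • gzGrad i hik j (proj k hk x)) := by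
  have h := (embedLinear n k).map_smul (t * ((j : ℂ) + 1)) (embed k (proj i hik (proj k hk x) ^ j))
  change embed n ((t * ((j : ℂ) + 1)) • embed k (proj i hik (proj k hk x) ^ j)) =
    (t * ((j : ℂ) + 1)) • embed n (embed k (proj i hik (proj k hk x) ^ j)) at h
  rw [gzGrad, gzGrad, smul_smul, smul_smul, h, embed_embed hik]
  rfl

/-- This lifts flows of a corner to flows of the whole matrix, so that corners can be matched before
the borders. -/
theorem proj_gzFlow {n i k : ℕ} (hik : i ≤ k) (hk : k ≤ n) (j : ℕ) (t : ℂ) (x : Mat n) :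
    proj k hk (gzFlow i (hik.trans hk) j t x) = gzFlow i hik j t (proj k hk x) := by
  have h0 : Commute (NormedSpace.exp (t • gzGrad i (hik.trans hk) j x)) (cornerOne n k) :=
    ((cornerOne_commute (hik.trans hk) hik j x).smul_left t).exp_left
  have h1 := corner_conj (Matrix.isUnit_exp _) h0 x
  have hneg : ∀ y : Mat k, -embed n y = embed n (-y) := fun y => ((embedLinear n k).map_neg y).symm
  rw [← embed_proj hk, ← embed_proj hk, ← Matrix.exp_neg, smul_gzGrad_eq_embed hik hk,
    exp_embed_mul hk, hneg, embed_mul_exp hk, Matrix.exp_neg] at h1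
  have h2 := congrArg (proj k hk) h1
  rw [proj_embed, proj_embed] at h2
  rw [gzFlow, gzFlow, smul_gzGrad_eq_embed hik hk, ← h2, ← Matrix.exp_neg, hneg]

theorem exists_mem_orbitA_proj_eq {n : ℕ} {x : Mat (n + 1)} {z : Mat n}
    (hz : z ∈ orbitA (proj n (Nat.le_succ n) x)) :
    ∃ x' ∈ orbitA x, proj n (Nat.le_succ n) x' = z := by
  refine orbitA_induction hz (fun z => ∃ x' ∈ orbitA x, proj n (Nat.le_succ n) x' = z)
    ⟨x, mem_orbitA_self x, rfl⟩ ?_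
  rintro i hi j hj t _ ⟨x', hx', rfl⟩
  exact ⟨_, mem_orbitA_trans hx' (gzFlow_mem_orbitA (hi.trans (Nat.lt_succ_self n)) hj t x'),
    proj_gzFlow hi.le (Nat.le_succ n) j t x'⟩

/-- `lastCol` as a linear map. -/
def lastColLinear (n : ℕ) : Mat (n + 1) →ₗ[ℂ] (Fin n → ℂ) where
  toFun := lastCol
  map_add' _ _ := rfl
  map_smul' _ _ := rfl

theorem lastCol_embed_mul {n : ℕ} (y : Mat n) (z : Mat (n + 1)) :
    lastCol (embed (n + 1) y * z) = y *ᵥ lastCol z := by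
  funext a
  rw [lastCol, Matrix.mul_apply, Fin.sum_univ_castSucc, (embed_apply_last le_rfl y _).1, zero_mul,
    add_zero]
  refine Finset.sum_congr rfl fun b _ => ?_
  congr 1
  simp only [embed, Matrix.of_apply, Fin.val_castSucc]
  rw [dif_pos ⟨a.isLt, b.isLt⟩]

theorem lastCol_mul_embed {n : ℕ} (y : Mat n) (z : Mat (n + 1)) :
    lastCol (z * embed (n + 1) y) = 0 := by
  funext a
  rw [lastCol, Matrix.mul_apply]
  exact Finset.sum_eq_zero fun b _ => by rw [(embed_apply_last le_rfl y b).1, mul_zero]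

theorem lastCol_exp_embed_mul {n : ℕ} (y : Mat n) (z : Mat (n + 1)) :
    lastCol (NormedSpace.exp (embed (n + 1) y) * z) = NormedSpace.exp y *ᵥ lastCol z := by
  refine map_exp_eq (embed (n + 1) y) y (lastColLinear n ∘ₗ LinearMap.mulRight ℂ z)
    ((Matrix.mulVecBilin ℂ ℂ).flip (lastCol z)) fun j => ?_
  change lastCol (embed (n + 1) y ^ j * z) = y ^ j *ᵥ lastCol z
  induction j with
  | zero => simp
  | succ j ih => rw [pow_succ', mul_assoc, lastCol_embed_mul, ih, pow_succ', Matrix.mulVec_mulVec]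

theorem lastCol_mul_exp_embed {n : ℕ} (y : Mat n) (z : Mat (n + 1)) :
    lastCol (z * NormedSpace.exp (embed (n + 1) y)) = lastCol z := by
  have h := map_exp_eq (embed (n + 1) y) (0 : Mat (n + 1)) (lastColLinear n ∘ₗ LinearMap.mulLeft ℂ z)
    (lastColLinear n ∘ₗ LinearMap.mulLeft ℂ z) fun j => by
      change lastCol (z * embed (n + 1) y ^ j) = lastCol (z * 0 ^ j)
      cases j with
      | zero => simp
      | succ j =>
        rw [pow_succ, ← mul_assoc, lastCol_mul_embed, pow_succ, mul_zero, mul_zero]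
        rfl
  rw [NormedSpace.exp_zero] at h
  exact h.trans (congrArg lastCol (mul_one z))

/-- The inverse exponential on the right does not touch the last column, so the flow acts on it
linearly through the exponential of the corner power. -/
theorem lastCol_gzFlow {n : ℕ} (j : ℕ) (t : ℂ) (x : Mat (n + 1)) :
    lastCol (gzFlow n (Nat.le_succ n) j t x) =
      NormedSpace.exp ((t * ((j : ℂ) + 1)) • proj n (Nat.le_succ n) x ^ j) *ᵥ lastCol x := by
  have h1 : t • gzGrad n (Nat.le_succ n) j x =
      embed (n + 1) ((t * ((j : ℂ) + 1)) • proj n (Nat.le_succ n) x ^ j) := by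
    rw [gzGrad, smul_smul]
    exact ((embedLinear (n + 1) n).map_smul _ _).symm
  have h2 : -(t • gzGrad n (Nat.le_succ n) j x) =
      embed (n + 1) (-((t * ((j : ℂ) + 1)) • proj n (Nat.le_succ n) x ^ j)) := by
    rw [h1]
    exact ((embedLinear (n + 1) n).map_neg _).symm
  rw [gzFlow, ← Matrix.exp_neg, h2, lastCol_mul_exp_embed, h1, lastCol_exp_embed_mul]

theorem proj_gzFlow_self {n : ℕ} (j : ℕ) (t : ℂ) (x : Mat (n + 1)) :
    proj n (Nat.le_succ n) (gzFlow n (Nat.le_succ n) j t x) = proj n (Nat.le_succ n) x := by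
  -- The gradient with index 1 is twice the embedded corner, so its invariance is the invariance of
  -- the corner.
  have h := gzGrad_flow_of_le (Nat.le_succ n) (Nat.le_succ n) le_rfl j 1 t x
  have h2 := congrArg (proj n (Nat.le_succ n)) h
  rw [gzGrad, gzGrad, map_smul, map_smul, proj_embed, proj_embed, pow_one, pow_one] at h2
  exact smul_right_injective _ (Nat.cast_add_one_ne_zero 1) h2

/-! ### Transitivity of the action on each piece -/

theorem exists_eq_smul_add_mulVec {m : ℕ} {N : Mat (m + 1)} (hN : IsNilpotent N)
    {u : Fin (m + 1) → ℂ} (hu : N ^ m *ᵥ u ≠ 0) (w : Fin (m + 1) → ℂ) :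
    ∃ (c : ℂ) (w' : Fin (m + 1) → ℂ), w = c • u + N *ᵥ w' := by
  obtain ⟨c, hc⟩ := exists_eq_sum_pow_mulVec
    (by rw [pow_eq_zero_of_isNilpotent hN, Matrix.zero_mulVec]) hu w
  refine ⟨c 0, ∑ j : Fin m, c j.succ • (N ^ j.val *ᵥ u), ?_⟩
  rw [hc, Fin.sum_univ_succ, Matrix.mulVec_sum]
  simp only [Fin.val_zero, pow_zero, Matrix.one_mulVec, Fin.val_succ, Matrix.mulVec_smul,
    Matrix.mulVec_mulVec, ← pow_succ']

/-- Since the last row vanishes, x^(k+1) applied to the last basis vector is N^k u followed by 0,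
and that basis vector is cyclic for x. -/
theorem pow_mulVec_lastCol_ne_zero {S : ℕ → Bool} {m : ℕ} (hS : S (m + 1) = true)
    {x : Mat (m + 2)} (hx : x ∈ regTriangular (signOrder S (m + 2))) :
    proj (m + 1) (Nat.le_succ _) x ^ m *ᵥ lastCol x ≠ 0 := by
  have hrow : ∀ a, x (Fin.last (m + 1)) a = 0 := fun a => hx.1 _ _ (signOrder_le_last hS a)
  have key : ∀ k, x ^ (k + 1) *ᵥ Pi.single (Fin.last (m + 1)) 1 =
      Fin.snoc (α := fun _ => ℂ) (proj (m + 1) (Nat.le_succ _) x ^ k *ᵥ lastCol x) 0 := by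
    intro k
    induction k with
    | zero =>
      funext a
      refine Fin.lastCases ?_ (fun a => ?_) a
      · simp [hrow]
      · simp [lastCol]
    | succ k ih =>
      rw [pow_succ', ← Matrix.mulVec_mulVec, ih, pow_succ', ← Matrix.mulVec_mulVec]
      funext a
      refine Fin.lastCases ?_ (fun a => ?_) a
      · rw [Fin.snoc_last, Matrix.mulVec, dotProduct]
        exact Finset.sum_eq_zero fun b _ => by rw [hrow, zero_mul]
      · rw [Fin.snoc_castSucc, Matrix.mulVec, dotProduct, Fin.sum_univ_castSucc, Fin.snoc_last,
          mul_zero, add_zero]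
        simp only [Fin.snoc_castSucc]
        rfl
  intro h
  have h1 := pow_mulVec_last_ne_zero hS hx
  rw [key, h] at h1
  refine h1 (funext fun a => ?_)
  refine Fin.lastCases ?_ (fun a => ?_) a <;> simp

/-- Expand one column in the basis N^j applied to the other. The scaling flow makes the leading
coefficient 1, and the flow of N^k then removes the error of order k for k = 1, …, m in turn. Since
N^(m+1) = 0 the columns end up equal, and the last rows are zero. -/
theorem mem_orbitA_of_proj_eq {S : ℕ → Bool} {m : ℕ} (hS : S (m + 1) = true) {x y : Mat (m + 2)}
    (hx : x ∈ regTriangular (signOrder S (m + 2))) (hy : y ∈ regTriangular (signOrder S (m + 2)))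
    (hxy : proj (m + 1) (Nat.le_succ _) x = proj (m + 1) (Nat.le_succ _) y) : y ∈ orbitA x := by
  obtain ⟨N, hN⟩ : ∃ N, N = proj (m + 1) (Nat.le_succ _) y := ⟨_, rfl⟩
  have hNn : IsNilpotent N := hN ▸ isNilpotent_of_strict (proj_mem_regTriangular _ hy).1
  have hu := pow_mulVec_lastCol_ne_zero hS hx
  have hu' := pow_mulVec_lastCol_ne_zero hS hy
  rw [hxy, ← hN] at hu
  rw [← hN] at hu'
  have key : ∀ k ≤ m, ∃ x' ∈ orbitA x, proj (m + 1) (Nat.le_succ _) x' = N ∧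
      ∃ w, lastCol x' = lastCol y + N ^ (k + 1) *ᵥ w := by
    intro k
    induction k with
    | zero =>
      intro _
      obtain ⟨c, w, hw⟩ := exists_eq_smul_add_mulVec hNn hu' (lastCol x)
      have hc : c ≠ 0 := by
        rintro rfl
        rw [zero_smul, zero_add] at hw
        rw [hw, Matrix.mulVec_mulVec, ← pow_succ, pow_eq_zero_of_isNilpotent hNn,
          Matrix.zero_mulVec] at hu
        exact hu rfl
      -- For j = 0 the flow scales the column by the exponential of the time; here the factor is
      -- c⁻¹.
      refine ⟨gzFlow (m + 1) (Nat.le_succ _) 0 (Complex.log c⁻¹) x,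
        gzFlow_mem_orbitA (Nat.lt_succ_self _) (Nat.succ_pos m) _ _, ?_, c⁻¹ • w, ?_⟩
      · rw [proj_gzFlow_self, hxy, hN]
      · have h1 : ((Complex.log c⁻¹ * (((0 : ℕ) : ℂ) + 1)) •
            proj (m + 1) (Nat.le_succ _) x ^ 0) *ᵥ lastCol x = Complex.log c⁻¹ • lastCol x := by
          simp [Matrix.smul_mulVec]
        rw [lastCol_gzFlow, exp_mulVec_of_eigen h1, Complex.exp_log (inv_ne_zero hc), hw, smul_add,
          smul_smul, inv_mul_cancel₀ hc, one_smul, zero_add, pow_one, Matrix.mulVec_smul]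
    | succ k ih =>
      intro hk
      obtain ⟨x', hx', hp, w, hw⟩ := ih (by omega)
      obtain ⟨c, w', hw'⟩ := exists_eq_smul_add_mulVec hNn hu' w
      have hk0 : ((k + 1 : ℕ) : ℂ) + 1 ≠ 0 := Nat.cast_add_one_ne_zero _
      -- The time is divided by the factor j + 1 of the gradient, so the exponent is exactly -c
      -- N^(k+1).
      refine ⟨gzFlow (m + 1) (Nat.le_succ _) (k + 1) (-c / (((k + 1 : ℕ) : ℂ) + 1)) x',
        mem_orbitA_trans hx' (gzFlow_mem_orbitA (Nat.lt_succ_self _) (by omega) _ _), ?_, ?_⟩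
      · rw [proj_gzFlow_self, hp]
      · rw [lastCol_gzFlow, hp, div_mul_cancel₀ _ hk0]
        obtain ⟨B, hB⟩ := exp_eq_one_add_add (-c • N ^ (k + 1))
        have e1 : N ^ (k + 1) *ᵥ w = N ^ (k + 1) *ᵥ (c • lastCol y) + N ^ (k + 2) *ᵥ w' := by
          conv_lhs => rw [hw']
          rw [Matrix.mulVec_add, Matrix.mulVec_mulVec, ← pow_succ]
        have e2 : ∀ v : Fin (m + 1) → ℂ, N ^ (k + 1) *ᵥ (N ^ (k + 1) *ᵥ v) =
            N ^ (k + 2) *ᵥ (N ^ k *ᵥ v) := by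
          intro v
          rw [Matrix.mulVec_mulVec, Matrix.mulVec_mulVec, ← pow_add, ← pow_add]
          congr 2
          omega
        -- The three terms are the rest of the old error, the cross term, and the second-order tail
        -- of the exponential; the last two carry N^(2k+2) = N^(k+2) N^k.
        refine ⟨w' + N ^ k *ᵥ (-c • w) + N ^ k *ᵥ ((c * c) • (B *ᵥ lastCol x')), ?_⟩
        have e3 : ((-c • N ^ (k + 1)) ^ 2 * B) *ᵥ lastCol x' =
            N ^ (k + 2) *ᵥ (N ^ k *ᵥ ((c * c) • (B *ᵥ lastCol x'))) := by
          rw [← e2, sq, ← Matrix.mulVec_mulVec, ← Matrix.mulVec_mulVec]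
          simp only [Matrix.smul_mulVec, Matrix.mulVec_smul, smul_smul]
          congr 1
          ring
        rw [hB, Matrix.add_mulVec, Matrix.add_mulVec, Matrix.one_mulVec, e3, Matrix.mulVec_add,
          Matrix.mulVec_add, ← add_assoc]
        congr 1
        rw [hw, Matrix.mulVec_add, Matrix.smul_mulVec, Matrix.smul_mulVec, e1, ← e1, ← e2,
          Matrix.mulVec_smul, Matrix.mulVec_smul, e1, Matrix.mulVec_smul]
        module
  obtain ⟨x', hx', hp, w, hw⟩ := key m le_rfl
  rw [pow_eq_zero_of_isNilpotent hNn, Matrix.zero_mulVec, add_zero] at hw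
  have hx'r := orbitA_subset_regTriangular hx hx'
  have : x' = y := by
    ext a b
    induction a using Fin.lastCases with
    | last => rw [hx'r.1 _ _ (signOrder_le_last hS b), hy.1 _ _ (signOrder_le_last hS b)]
    | cast a =>
      induction b using Fin.lastCases with
      | last => exact congrFun hw a
      | cast b => exact congrFun (congrFun (hp.trans hN) a) b
  exact this ▸ hx'

theorem mem_orbitA_of_mem_regTriangular {n : ℕ} {S : ℕ → Bool} {x y : Mat n}
    (hx : x ∈ regTriangular (signOrder S n)) (hy : y ∈ regTriangular (signOrder S n)) :
    y ∈ orbitA x := by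
  induction n generalizing S with
  | zero => rw [Subsingleton.elim y x]; exact mem_orbitA_self x
  | succ n ih =>
    rcases n with _ | m
    · have : y = x := by
        ext a b
        have hab : a = b := Fin.ext (by omega)
        rw [hx.1 a b (by rw [hab]), hy.1 a b (by rw [hab])]
      rw [this]; exact mem_orbitA_self x
    have step : ∀ {S : ℕ → Bool} {x y : Mat (m + 2)}, S (m + 1) = true →
        x ∈ regTriangular (signOrder S (m + 2)) → y ∈ regTriangular (signOrder S (m + 2)) →
        y ∈ orbitA x := by
      intro S x y hS hx hy
      obtain ⟨x', hx', hp⟩ := exists_mem_orbitA_proj_eq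
        (ih (proj_mem_regTriangular (Nat.le_succ _) hx) (proj_mem_regTriangular (Nat.le_succ _) hy))
      exact mem_orbitA_trans hx'
        (mem_orbitA_of_proj_eq hS (orbitA_subset_regTriangular hx hx') hy hp)
    cases hS : S (m + 1) with
    | true => exact step hS hx hy
    | false =>
      have h := step (S := fun b => !S b) (by simp [hS]) (transpose_mem_regTriangular hx)
        (transpose_mem_regTriangular hy)
      exact transpose_mem_orbitA h

theorem orbitA_eq_regTriangular {S : ℕ → Bool} {n : ℕ} {x : Mat n}
    (hx : x ∈ regTriangular (signOrder S n)) : orbitA x = regTriangular (signOrder S n) :=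
  Set.Subset.antisymm (orbitA_subset_regTriangular hx) fun _ hy =>
    mem_orbitA_of_mem_regTriangular hx hy

/-! ### Finite sequences of signs -/

/-- The sequence of signs given by the signs at the positions `1, …, n - 1`. -/
def extendSigns {n : ℕ} (s : Fin (n - 1) → Bool) (b : ℕ) : Bool :=
  if h : b - 1 < n - 1 then s ⟨b - 1, h⟩ else true

theorem extendSigns_succ {n : ℕ} (s : Fin (n - 1) → Bool) (m : Fin (n - 1)) :
    extendSigns s (m.val + 1) = s m := by
  simp [extendSigns]

/-- The sign at index 0 is immaterial because both of its values give position 0. -/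
theorem signOrder_extendSigns (S : ℕ → Bool) (n : ℕ) :
    signOrder (extendSigns fun m : Fin (n - 1) => S (m.val + 1)) n = signOrder S n := by
  funext b
  rcases Nat.eq_zero_or_pos b.val with h | h
  · simp [signOrder, h]
  · have hb := b.isLt
    have : extendSigns (fun m : Fin (n - 1) => S (m.val + 1)) b.val = S b.val := by
      rw [extendSigns, dif_pos (by omega)]
      congr 1
      simp only
      omega
    rw [signOrder, signOrder, this]

end GelfandZeitlin

/-! ### The main theorem -/

open GelfandZeitlin in
theorem theorem3p11 (n : ℕ) (hn : 1 ≤ n) :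
    ∃ b : (Fin (n - 1) → Bool) → LieSubalgebra ℂ (Mat n),
      (∀ s, towerBorels s = {b s}) ∧
      Function.Injective b ∧
      Pairwise (fun s s' => Disjoint (regNilpotents (b s)) (regNilpotents (b s'))) ∧
      nilfiberSreg n = (⋃ s, regNilpotents (b s)) ∧
      zariskiComponents (nilfiberSreg n) = Set.range (fun s => regNilpotents (b s)) ∧
      zariskiComponents (nilfiberSreg n) = {O | ∃ x ∈ nilfiberSreg n, O = orbitA x} ∧
      (zariskiComponents (nilfiberSreg n)).ncard = 2 ^ (n - 1) := by
  let b : (Fin (n - 1) → Bool) → LieSubalgebra ℂ (Mat n) := fun s => towerBorel (extendSigns s) n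
  have hb : ∀ s, regNilpotents (b s) = regTriangular (signOrder (extendSigns s) n) := fun s =>
    regNilpotents_towerBorel _ n
  have hne : ∀ s, (regNilpotents (b s)).Nonempty := fun s => by
    rw [hb]; exact regTriangular_nonempty _
  have hinj : ∀ s s' x, x ∈ regNilpotents (b s) → x ∈ b s' → s = s' := by
    intro s s' x hx hx'
    rw [hb] at hx
    funext m
    have hm := m.isLt
    have := sign_eq_of_mem_regTriangular hx hx' (Nat.succ_pos m.val) (by omega)
    rwa [Nat.succ_eq_add_one, extendSigns_succ, extendSigns_succ] at this
  have hdisj : Pairwise fun s s' => Disjoint (regNilpotents (b s)) (regNilpotents (b s')) :=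
    fun s s' hss => Set.disjoint_left.2 fun x hx hx' => hss (hinj s s' x hx hx'.1)
  have hunion : nilfiberSreg n = ⋃ s, regNilpotents (b s) := by
    refine Set.Subset.antisymm (fun x hx => ?_) (Set.iUnion_subset fun s => ?_)
    · obtain ⟨S, hS⟩ := exists_mem_regTriangular hx
      refine Set.mem_iUnion.2 ⟨fun m => S (m.val + 1), ?_⟩
      rwa [hb, signOrder_extendSigns]
    · rw [hb]
      exact regTriangular_subset_nilfiberSreg _ n
  have hcomp : zariskiComponents (nilfiberSreg n) = Set.range fun s => regNilpotents (b s) := by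
    let _ := zariski n
    -- The closed sets that cut out the pieces are the Borel subalgebras themselves.
    refine image_irreducibleComponents (Z := fun s => (b s : Set (Mat n))) hunion (fun s => ?_)
      hdisj (fun s => isClosed_triangular _) fun s => ?_
    · rw [hb]
      exact isIrreducible_regTriangular _
    · ext x
      rw [hunion]
      constructor
      · rintro ⟨hx, hxs⟩
        obtain ⟨s', hs'⟩ := Set.mem_iUnion.1 hx
        rwa [← hinj s' s x hs' hxs]
      · exact fun hx => ⟨Set.mem_iUnion.2 ⟨s, hx⟩, hx.1⟩
  have hbinj : Function.Injective fun s => regNilpotents (b s) := by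
    intro s s' h
    obtain ⟨x, hx⟩ := hne s
    have hx' : x ∈ regNilpotents (b s') := by
      have h' : regNilpotents (b s) = regNilpotents (b s') := h
      rwa [← h']
    exact hinj s s' x hx hx'.1
  refine ⟨b, fun s => towerBorels_eq hn (extendSigns_succ s), ?_, hdisj, hunion, hcomp, ?_, ?_⟩
  · intro s s' h
    exact hbinj (congrArg regNilpotents h)
  · rw [hcomp]
    ext O
    constructor
    · rintro ⟨s, rfl⟩
      obtain ⟨x, hx⟩ := hne s
      refine ⟨x, hunion ▸ Set.mem_iUnion.2 ⟨s, hx⟩, ?_⟩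
      simp only [hb] at hx ⊢
      exact (orbitA_eq_regTriangular hx).symm
    · rintro ⟨x, hx, rfl⟩
      obtain ⟨s, hs⟩ := Set.mem_iUnion.1 (hunion ▸ hx)
      refine ⟨s, ?_⟩
      simp only [hb] at hs ⊢
      exact (orbitA_eq_regTriangular hs).symm
  · rw [hcomp, Set.ncard_range_of_injective hbinj]
    simp
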